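/- **Setting.** Fix a signature of uninterpreted function symbols (many-sorted; constants are 0-ary, predicates are Boolean-valued functions) together with linear rational arithmetic (rational constants, $+$, multiplication by rational constants, $\le$). Atoms are equalities $t_1=t_2$ and linear inequalities $c_1 t_1+\dots+c_n t_n\le c$; a literal is an atom or its negation, and arithmetic conversions are applied implicitly. For a formula $\varphi$ let $\mathrm{symb}(\varphi)$ be its set of uninterpreted symbols. Let $T$ be a finite binary tree whose edges point to the root (every inner node has exactly two children), $P$ its set of leaves ("partitions"), $\mathrm{st}(v)\subseteq P$ the set of leaves below $v$, and let each $p\in P$ be labelled by a CNF formula $F(p)$, whose clauses consist of ground literals and of universally quantified clauses $\forall\bar x.\,\ell_1(\bar x)\vee\dots\vee\ell_n(\bar x)$ used as ("proxy") literals. A *tree interpolant* assigns a closed formula $I(v)$ to every node $v$ such that (1) $I(\mathrm{root})\equiv\bot$; (2) $F(p)$ implies $I(p)$ for each leaf $p$; (3) for each inner node $v$ with children $v_1,v_2$, $I(v_1)\wedge I(v_2)$ implies $I(v)$; (4) $\mathrm{symb}(I(v))\subseteq\bigcup_{p\in \mathrm{st}(v)}\mathrm{symb}(F(p))\cap\bigcup_{p\notin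 \mathrm{st}(v)}\mathrm{symb}(F(p))$. Consider a resolution proof (a DAG) of the empty clause whose leaves are input clauses (each from one $F(p)$), instantiation lemmas $\neg(\forall\bar x.\phi(\bar x))\vee\phi(\bar t)$, and theory lemmas of four kinds: transitivity $t_1\ne t_2\vee\dots\vee t_{n-1}\neq t_n\vee t_1=t_n$; congruence $f(\bar t)=f(\bar s)\vee t_1\ne s_1\vee\dots\vee t_n\ne s_n$; trichotomy $t_1=t_2\vee t_1>t_2\vee t_1<t_2$; Farkas $\neg(s_1\le b_1)\vee\dots\vee\neg(s_n\le b_n)$ with coefficients $k_i>0$, $\sum k_is_i=0$, $\sum k_ib_i<0$. Assume that every uninterpreted symbol of the proof occurs in some $F(p)$. Let $\mathrm{colour}$ map each atom to a partition (a literal and its negation have the same colour): arbitrary on ordinary atoms, while a quantified proxy atom is coloured by a partition in whose formula it occurs, and by $p$ if it occurs in an input clause that the proof takes from $p$. **Algorithm.** For a ground term $t$ let $v_t$ be a fresh variable; flattening an atom replaces its top-level terms $t$ by $v_t$ (proxy atoms are unchanged). For a clause $C$ and $A\subseteq P$, let $K_A(C)$ be the conjunction of the flattened negations of the literals of $C$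 with colour in $A$, and $\overline A=P\setminus A$. The variable $v_t$ is *supported* by $C$ if $t$ is a subterm of a non-proxy literal of $C$. Put $\mathrm{partitions}(f)=\{p: f\in\mathrm{symb}(F(p))\}$ for uninterpreted $f$ and $\mathrm{partitions}(f)=P$ for theory symbols. Each proof node gets one formula $I_A$ for each tree node $v$, where $A=\mathrm{st}(v)$: * Input clause $C$ from $p$; instantiation lemma $C$ with $p=\mathrm{colour}(\forall\bar x.\phi)$; congruence lemma $C$ for $f$ with an arbitrary $p\in\mathrm{partitions}(f)$ (the same for all $v$): $I_A=\neg K_{\overline A}(C)$ if $p\in A$, and $I_A=K_A(C)$ otherwise. * Transitivity: arrange the literals $t_1\neq t_n,\ t_1=t_2,\dots,t_{n-1}=t_n$ cyclically and let $i_1<\dots<i_m$ be the indices of the terms at which exactly one of the two adjacent literals has its colour in $A$. If $m=0$, $I_A$ is $\bot$ if all colours are in $A$ and $\top$ if none is. Otherwise $I_A$ is $v_{t_{i_1}}=v_{t_{i_2}}\wedge v_{t_{i_3}}=v_{t_{i_4}}\wedge\dots\wedge v_{t_{i_{m-1}}}=v_{t_{i_m}}$ if $\mathrm{colour}(t_1=t_n)\notin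 A$, and $v_{t_{i_2}}=v_{t_{i_3}}\wedge\dots\wedge v_{t_{i_{m-2}}}=v_{t_{i_{m-1}}}\wedge v_{t_{i_m}}\neq v_{t_{i_1}}$ if it is in $A$. * Trichotomy: $K_A(C)$ or $\neg K_{\overline A}(C)$, at choice. * Farkas: $\bot$ if all $s_i\le b_i$ have their colour in $A$; otherwise $\sum k_i\hat s_i\le\sum k_ib_i$, both sums over the $i$ with $\mathrm{colour}(s_i\le b_i)\in A$, where $\hat s_i$ is the flattened $s_i$. * Resolution of $C_1\vee\ell$ (labels $I^1$) and $C_2\vee\neg\ell$ (labels $I^2$): start with $I^1_A\vee I^2_A$ if $\mathrm{colour}(\ell)\in A$ and $I^1_A\wedge I^2_A$ otherwise. Then, as long as some label contains a free variable not supported by $C_1\vee C_2$, choose such a $v_t$, $t=f(t_1,\dots,t_n)$, where $t$ is not a proper subterm of any $t'$ with $v_{t'}$ free in some label, and in every label $I_A$ that contains $v_t$ (the same $v_t$ for all tree nodes at the same time) replace $I_A$ by $\exists x.\,I_A\{v_t\mapsto x\}$ if $\mathrm{partitions}(f)\subseteq A$, by $\forall x.\,I_A\{v_t\mapsto x\}$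 if $\mathrm{partitions}(f)\cap A=\emptyset$, and by $I_A\{v_t\mapsto f(v_{t_1},\dots,v_{t_n})\}$ otherwise. **Theorem 3.** For every such proof and every such colouring, the algorithm is well defined and terminates (every sequence of variable removals is finite, and a complete labelling of the proof exists), and, for all choices made during its run, the labelling it computes for the empty clause at the root of the proof is a tree interpolant of $(T,F)$. It may contain quantifiers. -/

import Mathlib

namespace TreeInterp

open Set Relation

noncomputable section

/-! ## Sorts, symbols and terms -/

/-- The sorts: rationals, Booleans, and the uninterpreted sorts. -/
inductive Srt (U : Type) : Type
  | rat : Srt U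
  | bool : Srt U
  | un (u : U) : Srt U

/-- A signature of uninterpreted function symbols. Constants are `0`-ary functions, and
predicates are functions with values of sort `bool`. -/
structure Signature where
  /-- the uninterpreted sorts -/
  USort : Type
  /-- the uninterpreted function symbols -/
  Fn : Type
  /-- the sorts of the arguments -/
  fnDom : Fn → List (Srt USort)
  /-- the sort of the value -/
  fnCod : Fn → Srt USort

variable {S : Signature}

/-- Function symbols: the uninterpreted ones, and the theory symbols, namely rational constants,
binary addition, the unary multiplications by a rational constant, and the truth values. -/
inductive Sym (S : Signature) : Type
  | fn (g : S.Fn) : Sym S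
  | num (q : ℚ) : Sym S
  | add : Sym S
  | smul (c : ℚ) : Sym S
  | truth (b : Bool) : Sym S

/-- Argument sorts of a symbol. -/
def Sym.dom : Sym S → List (Srt S.USort)
  | .fn g => S.fnDom g
  | .num _ => []
  | .add => [.rat, .rat]
  | .smul _ => [.rat]
  | .truth _ => []

/-- Value sort of a symbol. -/
def Sym.cod : Sym S → Srt S.USort
  | .fn g => S.fnCod g
  | .num _ => .rat
  | .add => .rat
  | .smul _ => .rat
  | .truth _ => .bool

/-- The symbol as a set of uninterpreted symbols (theory symbols do not count). -/
def Sym.syms : Sym S → Set S.Fn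
  | .fn g => {g}
  | _ => ∅

/-- Well-sorted terms with variables from `X`. -/
inductive Term (S : Signature) (X : Srt S.USort → Type) : Srt S.USort → Type
  | var {s : Srt S.USort} (x : X s) : Term S X s
  | app (f : Sym S) (args : ∀ i : Fin f.dom.length, Term S X (f.dom.get i)) : Term S X f.cod

/-- No variables. -/
abbrev NoVar (S : Signature) : Srt S.USort → Type := fun _ => Empty

/-- The variables of quantified clauses: countably many of each sort. -/
abbrev QVar (S : Signature) : Srt S.USort → Type := fun _ => ℕ

/-- Ground terms. -/
abbrev GTerm (S : Signature) (s : Srt S.USort) : Type := Term S (NoVar S) s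

/-- The variables of interpolants: a flattening variable `v_t` for each ground term `t`, and
the (disjoint) supply `x_n` of variables that may be bound by a quantifier. -/
inductive Var (S : Signature) : Srt S.USort → Type
  | flat {s : Srt S.USort} (t : GTerm S s) : Var S s
  | bnd {s : Srt S.USort} (n : ℕ) : Var S s

/-- Uninterpreted symbols of a term. -/
def Term.syms {X : Srt S.USort → Type} : {s : Srt S.USort} → Term S X s → Set S.Fn
  | _, .var _ => ∅
  | _, .app f args => f.syms ∪ ⋃ i, (args i).syms

/-- Variables of a term. -/
def Term.vars {X : Srt S.USort → Type} : {s : Srt S.USort} → Term S X s → Set (Σ s, X s)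
  | _, .var x => {⟨_, x⟩}
  | _, .app _ args => ⋃ i, (args i).vars

/-- Simultaneous substitution. -/
def Term.subst {X Y : Srt S.USort → Type} (σ : ∀ x : (Σ s, X s), Term S Y x.1) :
    {s : Srt S.USort} → Term S X s → Term S Y s
  | _, .var x => σ ⟨_, x⟩
  | _, .app f args => .app f (fun i => (args i).subst σ)

/-- `Subterm t u`: `t` is a subterm of `u` (possibly `u` itself). -/
inductive Subterm {s : Srt S.USort} (t : GTerm S s) : {s' : Srt S.USort} → GTerm S s' → Prop
  | refl : Subterm t t
  | arg (f : Sym S) (args : ∀ i : Fin f.dom.length, GTerm S (f.dom.get i))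
      (i : Fin f.dom.length) : Subterm t (args i) → Subterm t (.app f args)

/-- `t` is a proper subterm of `u`. Equivalently, `v_t` occurs in the right-hand side of one of
the flattening equalities `v_{f(t₁,…,tₙ)} = f(v_{t₁},…,v_{tₙ})` of `u`. -/
def ProperSubterm {s s' : Srt S.USort} (t : GTerm S s) (u : GTerm S s') : Prop :=
  ∃ (f : Sym S) (args : ∀ i : Fin f.dom.length, GTerm S (f.dom.get i)) (i : Fin f.dom.length),
    Subterm (.app f args) u ∧
      (⟨_, args i⟩ : Σ s, GTerm S s) = ⟨s, t⟩

/-! ## Atoms, literals, formulas -/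

/-- Atoms: equalities, and linear inequalities `∑ c_t · t ≤ c`, where the left-hand side is a
formal linear combination of terms. -/
inductive Atom (S : Signature) (X : Srt S.USort → Type) : Type
  | eq {s : Srt S.USort} (t u : Term S X s) : Atom S X
  | le (L : Term S X .rat →₀ ℚ) (c : ℚ) : Atom S X

/-- The top-level terms of an atom. -/
def Atom.terms {X : Srt S.USort → Type} : Atom S X → Set (Σ s, Term S X s)
  | .eq t u => {⟨_, t⟩, ⟨_, u⟩}
  | .le L _ => {x | ∃ t ∈ L.support, x = ⟨.rat, t⟩}

/-- Uninterpreted symbols of an atom. -/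
def Atom.syms {X : Srt S.USort → Type} (a : Atom S X) : Set S.Fn := ⋃ t ∈ a.terms, t.2.syms

/-- Variables of an atom. -/
def Atom.vars {X : Srt S.USort → Type} (a : Atom S X) : Set (Σ s, X s) := ⋃ t ∈ a.terms, t.2.vars

/-- Substitution in an atom. -/
def Atom.subst {X Y : Srt S.USort → Type} (σ : ∀ x : (Σ s, X s), Term S Y x.1) :
    Atom S X → Atom S Y
  | .eq t u => .eq (t.subst σ) (u.subst σ)
  | .le L c => .le (L.mapDomain (fun t => t.subst σ)) c

/-- `a` is the equality of `t` and `u`, in one of its two orientations. -/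
def Atom.IsEq {s : Srt S.USort} (a : Atom S (NoVar S)) (t u : GTerm S s) : Prop :=
  a = .eq t u ∨ a = .eq u t

/-- A literal: an atom (`pos = true`) or its negation. The literal `x > y` is the negation of
`1·x + (-1)·y ≤ 0`. -/
structure Lit (α : Type) where
  pos : Bool
  atom : α

/-- The complementary literal. -/
def Lit.neg {α : Type} (l : Lit α) : Lit α := ⟨!l.pos, l.atom⟩

/-- A quantified clause `∀ x̄. ℓ₁(x̄) ∨ … ∨ ℓₙ(x̄)`: the list of its literals, universally
closed. -/
abbrev QClause (S : Signature) : Type := List (Lit (Atom S (QVar S)))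

/-- The atoms of a proof: ground atoms, and quantified clauses as proxy atoms. -/
inductive PAtom (S : Signature) : Type
  | base (a : Atom S (NoVar S)) : PAtom S
  | proxy (Q : QClause S) : PAtom S

/-- Clauses of a proof; a clause is read as the disjunction of its literals. -/
abbrev Clause (S : Signature) : Type := List (Lit (PAtom S))

/-- A formula in conjunctive normal form. -/
abbrev CNF (S : Signature) : Type := List (Clause S)

/-- First-order formulas. The formula `qclause Q` is the universal closure of the clause `Q`. -/
inductive Formula (S : Signature) : Type
  | top : Formula S
  | bot : Formula S
  | atom (a : Atom S (Var S)) : Formula S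
  | qclause (Q : QClause S) : Formula S
  | neg (φ : Formula S) : Formula S
  | and (φ ψ : Formula S) : Formula S
  | or (φ ψ : Formula S) : Formula S
  | all (s : Srt S.USort) (n : ℕ) (φ : Formula S) : Formula S
  | ex (s : Srt S.USort) (n : ℕ) (φ : Formula S) : Formula S

/-- Uninterpreted symbols of a formula. -/
def Formula.syms : Formula S → Set S.Fn
  | .top => ∅
  | .bot => ∅
  | .atom a => a.syms
  | .qclause Q => {g | ∃ l ∈ Q, g ∈ l.atom.syms}
  | .neg φ => φ.syms
  | .and φ ψ => φ.syms ∪ ψ.syms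
  | .or φ ψ => φ.syms ∪ ψ.syms
  | .all _ _ φ => φ.syms
  | .ex _ _ φ => φ.syms

/-- Free variables of a formula. -/
def Formula.free : Formula S → Set (Σ s, Var S s)
  | .top => ∅
  | .bot => ∅
  | .atom a => a.vars
  | .qclause _ => ∅
  | .neg φ => φ.free
  | .and φ ψ => φ.free ∪ ψ.free
  | .or φ ψ => φ.free ∪ ψ.free
  | .all s n φ => φ.free \ {⟨s, .bnd n⟩}
  | .ex s n φ => φ.free \ {⟨s, .bnd n⟩}

/-- All variables that occur in a formula, be it free, bound, or at a quantifier. -/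
def Formula.occ : Formula S → Set (Σ s, Var S s)
  | .top => ∅
  | .bot => ∅
  | .atom a => a.vars
  | .qclause _ => ∅
  | .neg φ => φ.occ
  | .and φ ψ => φ.occ ∪ ψ.occ
  | .or φ ψ => φ.occ ∪ ψ.occ
  | .all s n φ => insert ⟨s, .bnd n⟩ φ.occ
  | .ex s n φ => insert ⟨s, .bnd n⟩ φ.occ

/-- The index of a variable `x_n` of sort `s` that does not occur in the formula. -/
def Formula.fresh (φ : Formula S) (s : Srt S.USort) : ℕ :=
  sInf {n | (⟨s, .bnd n⟩ : Σ s, Var S s) ∉ φ.occ}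

open Classical in
/-- The substitution `{v_t ↦ r}`. -/
def replaceVar {s : Srt S.USort} (t : GTerm S s) (r : Term S (Var S) s) :
    ∀ x : (Σ s, Var S s), Term S (Var S) x.1 :=
  Function.update (fun x => .var x.2) ⟨s, .flat t⟩ r

/-- `φ{v_t ↦ r}`. It is only used when no variable of `r` is bound in `φ`; flattening variables
are never bound. -/
def Formula.replace {s : Srt S.USort} (t : GTerm S s) (r : Term S (Var S) s) :
    Formula S → Formula S
  | .top => .top
  | .bot => .bot
  | .atom a => .atom (a.subst (replaceVar t r))
  | .qclause Q => .qclause Q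
  | .neg φ => .neg (φ.replace t r)
  | .and φ ψ => .and (φ.replace t r) (ψ.replace t r)
  | .or φ ψ => .or (φ.replace t r) (ψ.replace t r)
  | .all s n φ => .all s n (φ.replace t r)
  | .ex s n φ => .ex s n (φ.replace t r)

/-- Finite conjunction. -/
def Formula.conj (l : List (Formula S)) : Formula S := l.foldr .and .top

/-- Finite disjunction. -/
def Formula.disj (l : List (Formula S)) : Formula S := l.foldr .or .bot

/-- A ground or proxy atom as a formula. -/
def PAtom.toFormula : PAtom S → Formula S
  | .base a => .atom (a.subst (fun x => x.2.elim))
  | .proxy Q => .qclause Q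

/-- The formula `φ` or its negation. -/
def Formula.signed (b : Bool) (φ : Formula S) : Formula S := if b then φ else .neg φ

/-- A clause as a formula. -/
def clauseFormula (C : Clause S) : Formula S :=
  .disj (C.map fun l => .signed l.pos l.atom.toFormula)

/-- A formula in conjunctive normal form as a formula. -/
def cnfFormula (K : CNF S) : Formula S := .conj (K.map clauseFormula)

/-! ## Semantics: uninterpreted functions with linear rational arithmetic -/

/-- Domains of the sorts, given the domains of the uninterpreted sorts. -/
@[reducible] def SrtDom {U : Type} (D : U → Type) : Srt U → Type
  | .rat => ℚ
  | .bool => Bool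
  | .un u => D u

/-- A model of the theory: nonempty domains of the uninterpreted sorts, and functions for the
uninterpreted symbols. -/
structure Model (S : Signature) where
  D : S.USort → Type
  nonempty : ∀ u, Nonempty (D u)
  fn : ∀ g : S.Fn, (∀ i : Fin (S.fnDom g).length, SrtDom D ((S.fnDom g).get i)) →
    SrtDom D (S.fnCod g)

/-- The domain of a sort. -/
abbrev Model.Dom (M : Model S) (s : Srt S.USort) : Type := SrtDom M.D s

/-- The interpretation of a symbol; theory symbols have their usual meaning. -/
def Model.interp (M : Model S) : (f : Sym S) →
    (∀ i : Fin f.dom.length, M.Dom (f.dom.get i)) → M.Dom f.cod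
  | .fn g => M.fn g
  | .num q => fun _ => q
  | .add => fun a =>
      let x : ℚ := a ⟨0, Nat.zero_lt_two⟩
      let y : ℚ := a ⟨1, Nat.one_lt_two⟩
      (x + y : ℚ)
  | .smul c => fun a =>
      let x : ℚ := a ⟨0, Nat.one_pos⟩
      (c * x : ℚ)
  | .truth b => fun _ => b

/-- Assignments to the variables. -/
abbrev Assign (M : Model S) (X : Srt S.USort → Type) : Type := ∀ x : (Σ s, X s), M.Dom x.1

/-- Value of a term. -/
def Term.eval {X : Srt S.USort → Type} (M : Model S) (ρ : Assign M X) :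
    {s : Srt S.USort} → Term S X s → M.Dom s
  | _, .var x => ρ ⟨_, x⟩
  | _, .app f args => M.interp f (fun i => (args i).eval M ρ)

/-- Truth of an atom when `e` gives the values of its top-level terms. -/
def Atom.Holds {X : Srt S.USort → Type} (M : Model S)
    (e : ∀ s : Srt S.USort, Term S X s → M.Dom s) : Atom S X → Prop
  | .eq t u => e _ t = e _ u
  | .le L c => (L.sum fun t k => k * (e .rat t : ℚ)) ≤ c

/-- Truth of an atom. -/
def Atom.eval {X : Srt S.USort → Type} (M : Model S) (ρ : Assign M X) (a : Atom S X) : Prop :=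
  a.Holds M (fun _ t => t.eval M ρ)

open Classical in
/-- Truth of a formula. -/
def Formula.eval (M : Model S) : Assign M (Var S) → Formula S → Prop
  | _, .top => True
  | _, .bot => False
  | ρ, .atom a => a.eval M ρ
  | _, .qclause Q => ∀ τ : Assign M (QVar S), ∃ l ∈ Q, (l.atom.eval M τ ↔ l.pos = true)
  | ρ, .neg φ => ¬ φ.eval M ρ
  | ρ, .and φ ψ => φ.eval M ρ ∧ ψ.eval M ρ
  | ρ, .or φ ψ => φ.eval M ρ ∨ ψ.eval M ρ
  | ρ, .all s n φ => ∀ d : M.Dom s, φ.eval M (Function.update ρ ⟨s, .bnd n⟩ d)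
  | ρ, .ex s n φ => ∃ d : M.Dom s, φ.eval M (Function.update ρ ⟨s, .bnd n⟩ d)

/-! ## Tree interpolation -/

/-- A binary tree as a directed graph; the edges point towards the root. -/
structure InterpTree (V : Type) where
  E : V → V → Prop
  root : V
  acyclic : ∀ v, ¬ TransGen E v v
  root_out : ∀ w, ¬ E root w
  out_unique : ∀ v, v ≠ root → ∃! w, E v w
  binary : ∀ v, (∀ u, ¬ E u v) ∨ ∃ a b, a ≠ b ∧ ∀ u, E u v ↔ u = a ∨ u = b

variable {V : Type}

/-- The partitions: the nodes without incoming edges. -/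
abbrev InterpTree.Leaf (T : InterpTree V) : Type := {v : V // ∀ u, ¬ T.E u v}

/-- The set `st(v)` of leaves in the subtree of `v`. -/
def InterpTree.st (T : InterpTree V) (v : V) : Set T.Leaf := {p | ReflTransGen T.E p.1 v}

/-- `I` is a tree interpolant for the tree `T` whose leaves are labelled by `F`. Interpolants
have no free variables, as the input has none. -/
structure IsTreeInterpolant (T : InterpTree V) (F : T.Leaf → Formula S) (I : V → Formula S) :
    Prop where
  root : ∀ (M : Model S) (ρ : Assign M (Var S)), ¬ (I T.root).eval M ρ
  leaf : ∀ (p : T.Leaf) (M : Model S) (ρ : Assign M (Var S)),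
    (F p).eval M ρ → (I p.1).eval M ρ
  inner : ∀ v a b : V, a ≠ b → T.E a v → T.E b v → ∀ (M : Model S) (ρ : Assign M (Var S)),
    (I a).eval M ρ → (I b).eval M ρ → (I v).eval M ρ
  symbols : ∀ v : V, (I v).syms ⊆ (⋃ p ∈ T.st v, (F p).syms) ∩ (⋃ p ∈ (T.st v)ᶜ, (F p).syms)
  closed : ∀ v : V, (I v).free = ∅

/-- The partitions of a symbol. Theory symbols may be used everywhere. -/
def partitions {P : Type} (F : P → Formula S) : Sym S → Set P
  | .fn g => {p | g ∈ (F p).syms}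
  | _ => univ

/-! ## Resolution proofs -/

/-- Two ground atoms agree up to arithmetic conversion: they are equivalent when only the theory
symbols are interpreted and all terms with an uninterpreted head symbol are treated as
variables. -/
def Atom.Conv (a b : Atom S (NoVar S)) : Prop :=
  ∀ (M : Model S) (e : ∀ s : Srt S.USort, GTerm S s → M.Dom s),
    (∀ (f : Sym S) (args : ∀ i : Fin f.dom.length, GTerm S (f.dom.get i)),
      f.syms = ∅ → e f.cod (.app f args) = M.interp f (fun i => e _ (args i))) →
    (a.Holds M e ↔ b.Holds M e)

/-- Literals that agree up to arithmetic conversion. -/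
inductive LitConv : Lit (PAtom S) → Lit (PAtom S) → Prop
  | same (l : Lit (PAtom S)) : LitConv l l
  | conv (b : Bool) (a a' : Atom S (NoVar S)) : a.Conv a' → LitConv ⟨b, .base a⟩ ⟨b, .base a'⟩

/-- Clauses that agree, literal by literal, up to arithmetic conversion. -/
def ClauseConv (C D : Clause S) : Prop := List.Forall₂ LitConv C D

/-- The instance of a quantified clause under a substitution of ground terms for its variables. -/
def QClause.inst (Q : QClause S) (θ : ∀ x : (Σ s, QVar S s), GTerm S x.1) : Clause S :=
  List.map (fun l => ⟨l.pos, .base (l.atom.subst θ)⟩) Q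

/-- One row of a Farkas lemma: coefficient `k` and inequality `L ≤ b`. -/
structure FarkasRow (S : Signature) where
  k : ℚ
  L : GTerm S .rat →₀ ℚ
  b : ℚ

/-- The atom `L ≤ b`. -/
def FarkasRow.atom (r : FarkasRow S) : PAtom S := .base (.le r.L r.b)

/-- How a node of the proof graph is obtained. `P` is the set of partitions and `N` the set of
nodes. -/
inductive Rule (S : Signature) (P N : Type) : Type
  /-- input clause from the partition `p` -/
  | input (p : P) : Rule S P N
  /-- instantiation lemma `¬(∀ x̄. Q) ∨ Qθ` -/
  | inst (Q : QClause S) (θ : ∀ x : (Σ s, QVar S s), GTerm S x.1) : Rule S P N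
  /-- transitivity lemma for the chain that starts in `t` and continues with the equalities and
  terms in `steps`; `d` is the equality of the end points -/
  | trans (s : Srt S.USort) (t : GTerm S s) (steps : List (Atom S (NoVar S) × GTerm S s))
      (d : Atom S (NoVar S)) : Rule S P N
  /-- congruence lemma `f(t̄) = f(ū) ∨ t₁ ≠ u₁ ∨ … ∨ tₙ ≠ uₙ` -/
  | cong (f : Sym S) (t u : ∀ i : Fin f.dom.length, GTerm S (f.dom.get i)) : Rule S P N
  /-- trichotomy lemma `t = u ∨ t > u ∨ t < u` -/
  | trich (t u : GTerm S .rat) : Rule S P N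
  /-- Farkas lemma -/
  | farkas (rows : List (FarkasRow S)) : Rule S P N
  /-- resolution of the clause at `j` with the clause at `k` on the pivot literal `l` -/
  | res (j k : N) (l : Lit (PAtom S)) : Rule S P N

/-- The listed atoms are the equalities `t = t₁`, `t₁ = t₂`, … of a chain that starts in `t`, and
`d` is the equality of `t₀` and the last term of the chain. -/
def IsChain {s : Srt S.USort} (t₀ : GTerm S s) (d : Atom S (NoVar S)) :
    GTerm S s → List (Atom S (NoVar S) × GTerm S s) → Prop
  | t, [] => d.IsEq t₀ t
  | t, (a, u) :: r => a.IsEq t u ∧ IsChain t₀ d u r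

/-- The clause `C` of node `i` is correctly obtained by the rule. The premises of resolution
steps come earlier, and clauses are compared as sets of literals there. -/
def Rule.Valid {P : Type} {n : ℕ} (K : P → CNF S) (clause : Fin n → Clause S) (i : Fin n) :
    Rule S P (Fin n) → Prop
  | .input p => ∃ C ∈ K p, ClauseConv C (clause i)
  | .inst Q θ => ∃ D, ClauseConv (QClause.inst Q θ) D ∧ clause i = ⟨false, .proxy Q⟩ :: D
  | .trans _ t steps d => IsChain t d t steps ∧
      clause i = steps.map (fun x => ⟨false, .base x.1⟩) ++ [⟨true, .base d⟩]
  | .cong f t u => ∃ (a : Atom S (NoVar S)) (b : Fin f.dom.length → Atom S (NoVar S)),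
      a.IsEq (.app f t) (.app f u) ∧ (∀ x, (b x).IsEq (t x) (u x)) ∧
      clause i = ⟨true, .base a⟩ :: List.ofFn (fun x => ⟨false, .base (b x)⟩)
  | .trich t u => ∃ a : Atom S (NoVar S), a.IsEq t u ∧
      clause i = [⟨true, .base a⟩,
        ⟨false, .base (.le (Finsupp.single t 1 - Finsupp.single u 1) 0)⟩,
        ⟨false, .base (.le (Finsupp.single u 1 - Finsupp.single t 1) 0)⟩]
  | .farkas rows => (∀ r ∈ rows, 0 < r.k) ∧ (rows.map fun r => r.k • r.L).sum = 0 ∧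
      (rows.map fun r => r.k * r.b).sum < 0 ∧
      clause i = rows.map (fun r => ⟨false, r.atom⟩)
  | .res j k l => j < i ∧ k < i ∧ ∃ C₁ C₂ : Clause S,
      {x | x ∈ clause j} = {x | x ∈ C₁} ∪ {l} ∧
      {x | x ∈ clause k} = {x | x ∈ C₂} ∪ {l.neg} ∧
      {x | x ∈ clause i} = {x | x ∈ C₁} ∪ {x | x ∈ C₂}

/-- A resolution proof of the unsatisfiability of the union of the input formulas `K p`, as a
directed acyclic graph with the empty clause at the root. -/
structure ResProof {P : Type} (K : P → CNF S) where
  size : ℕ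
  clause : Fin size → Clause S
  rule : Fin size → Rule S P (Fin size)
  valid : ∀ i, (rule i).Valid K clause i
  root : Fin size
  root_clause : clause root = []

/-- Every uninterpreted symbol in the proof occurs in an input formula. -/
def ResProof.SymbolsFromInput {P : Type} {K : P → CNF S} (π : ResProof K) : Prop :=
  ∀ i, ∀ g ∈ (clauseFormula (π.clause i)).syms, ∃ p, g ∈ (cnfFormula (K p)).syms

/-- Proxy literals are coloured with a partition in whose input they occur, and the proxy
literals in an input clause have the colour of that clause. There is no condition on the colours of
other literals. A literal and its negation have the same colour. -/
structure ResProof.Admissible {P : Type} {K : P → CNF S} (π : ResProof K)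
    (colour : PAtom S → P) : Prop where
  occurs : ∀ i, ∀ l ∈ π.clause i, ∀ Q, l.atom = .proxy Q →
    ∃ C ∈ K (colour (.proxy Q)), ∃ l' ∈ C, l'.atom = .proxy Q
  input : ∀ i p, π.rule i = .input p → ∀ l ∈ π.clause i, ∀ Q, l.atom = .proxy Q →
    colour (.proxy Q) = p

/-! ## The interpolation algorithm -/

/-- The flattening variable `v_t` as a term. -/
def flatVar {s : Srt S.USort} (t : GTerm S s) : Term S (Var S) s := .var (.flat t)

/-- The flattened linear combination. -/
def flatLin (L : GTerm S .rat →₀ ℚ) : Term S (Var S) .rat →₀ ℚ := L.mapDomain flatVar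

/-- The flattened version of an atom. Proxy atoms are not flattened. -/
def PAtom.flatten : PAtom S → Formula S
  | .base (.eq t u) => .atom (.eq (flatVar t) (flatVar u))
  | .base (.le L c) => .atom (.le (flatLin L) c)
  | .proxy Q => .qclause Q

/-- The flattened version of a literal. -/
def flattenLit (l : Lit (PAtom S)) : Formula S := .signed l.pos l.atom.flatten

/-- The variable `v_t` is supported by the clause `C`. -/
def Supported (C : Clause S) {s : Srt S.USort} (t : GTerm S s) : Prop :=
  ∃ l ∈ C, ∃ a, l.atom = .base a ∧ ∃ u ∈ a.terms, Subterm t u.2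

section Algorithm

variable {P : Type} (colour : PAtom S → P)

open Classical in
/-- The projection kernel of `¬C` to the set `A` of partitions: the conjunction of the flattened
literals of `¬C` with a colour in `A`. -/
def kernel (A : Set P) (C : Clause S) : Formula S :=
  .conj ((C.filter fun l => decide (colour l.atom ∈ A)).map fun l => flattenLit l.neg)

open Classical in
/-- The interpolant of a clause that is attributed to the partition `p`. -/
def attributed (p : P) (A : Set P) (C : Clause S) : Formula S :=
  if p ∈ A then .neg (kernel colour Aᶜ C) else kernel colour A C

open Classical in
/-- The boundary terms of a chain of equalities: those where exactly one of the two adjacent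
literals has its colour in `A`. Here `prev` and `close` tell whether the literals before the first
and after the last term have their colours in `A`. -/
def boundary (A : Set P) {s : Srt S.USort} (close : Bool) :
    Bool → GTerm S s → List (Atom S (NoVar S) × GTerm S s) → List (GTerm S s)
  | prev, t, [] => if prev = close then [] else [t]
  | prev, t, (a, u) :: r =>
      (if prev = decide (colour (.base a) ∈ A) then [] else [t]) ++
        boundary A close (decide (colour (.base a) ∈ A)) u r

/-- `v₁ = v₂ ∧ v₃ = v₄ ∧ …` (a last unpaired term is ignored). -/
def pairUp {s : Srt S.USort} : List (GTerm S s) → Formula S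
  | t :: u :: r => .and (.atom (.eq (flatVar t) (flatVar u))) (pairUp r)
  | _ => .top

open Classical in
/-- The interpolant of a transitivity lemma, from its boundary terms `i₁, …, iₘ`:
if `m = 0`, it is `⊥` or `⊤`; otherwise it is `v_{i₁} = v_{i₂} ∧ v_{i₃} = v_{i₄} ∧ …` if the
disequality is not in `A`, and `v_{i₂} = v_{i₃} ∧ … ∧ v_{iₘ} ≠ v_{i₁}` if it is. -/
def transInterp (A : Set P) {s : Srt S.USort} (t : GTerm S s)
    (steps : List (Atom S (NoVar S) × GTerm S s)) (d : Atom S (NoVar S)) : Formula S :=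
  match boundary colour A (decide (colour (.base d) ∈ A)) (decide (colour (.base d) ∈ A))
      t steps with
  | [] => if colour (.base d) ∈ A then .bot else .top
  | b :: r => if colour (.base d) ∈ A then
      .and (pairUp r) (.neg (.atom (.eq (flatVar (r.getLastD b)) (flatVar b))))
    else pairUp (b :: r)

open Classical in
/-- The interpolant of a Farkas lemma: the weighted sum of the flattened inequalities with a
colour in `A`. -/
def farkasInterp (A : Set P) (rows : List (FarkasRow S)) : Formula S :=
  if ∀ r ∈ rows, colour r.atom ∈ A then .bot
  else
    let rowsA := rows.filter fun r => decide (colour r.atom ∈ A)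
    .atom (.le (rowsA.map fun r => r.k • flatLin r.L).sum (rowsA.map fun r => r.k * r.b).sum)

end Algorithm

open Classical in
/-- Removal of the variable `v_t` for `t = f(t₁,…,tₙ)`, where `parts` is the set of partitions
of `f`. -/
def removeVar {P : Type} (parts A : Set P) (f : Sym S)
    (args : ∀ i : Fin f.dom.length, GTerm S (f.dom.get i)) (φ : Formula S) : Formula S :=
  if parts ⊆ A then
    .ex f.cod (φ.fresh f.cod) (φ.replace (.app f args) (.var (.bnd (φ.fresh f.cod))))
  else if parts ∩ A = ∅ then
    .all f.cod (φ.fresh f.cod) (φ.replace (.app f args) (.var (.bnd (φ.fresh f.cod))))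
  else φ.replace (.app f args) (.app f (fun i => flatVar (args i)))

section Algorithm

variable (T : InterpTree V) (F : T.Leaf → Formula S)

open Classical in
/-- One removal step after a resolution step with resolvent `C`: some unsupported variable `v_t`
that occurs in a label, and that is outermost among the free variables of the labels, is removed
from all labels in which it occurs. -/
def RemoveStep (C : Clause S) (J J' : V → Formula S) : Prop :=
  ∃ (f : Sym S) (args : ∀ i : Fin f.dom.length, GTerm S (f.dom.get i)),
    ¬ Supported C (.app f args) ∧
    (∃ v, (⟨_, .flat (.app f args)⟩ : Σ s, Var S s) ∈ (J v).free) ∧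
    (∀ (v : V) (s' : Srt S.USort) (t' : GTerm S s'),
      (⟨s', .flat t'⟩ : Σ s, Var S s) ∈ (J v).free → ¬ ProperSubterm (.app f args) t') ∧
    ∀ v, J' v = if (⟨_, .flat (.app f args)⟩ : Σ s, Var S s) ∈ (J v).free
      then removeVar (partitions F f) (T.st v) f args (J v) else J v

/-- Removal steps are repeated until all free variables are supported. -/
def RemoveAll (C : Clause S) (J J' : V → Formula S) : Prop :=
  ReflTransGen (RemoveStep T F C) J J' ∧
  ∀ (v : V) (s : Srt S.USort) (t : GTerm S s),
    (⟨s, .flat t⟩ : Σ s, Var S s) ∈ (J' v).free → Supported C t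

open Classical in
/-- The combination of the labels of the premises of a resolution step on `l`. -/
def combine (colour : PAtom S → T.Leaf) (l : Lit (PAtom S)) (I₁ I₂ : V → Formula S) :
    V → Formula S :=
  fun v => if colour l.atom ∈ T.st v then .or (I₁ v) (I₂ v) else .and (I₁ v) (I₂ v)

/-- The algorithm may label a node with clause `C` that is obtained by the given rule with `J`,
when `I` are the labels of the nodes of the proof. -/
def Rule.Computes {N : Type} (colour : PAtom S → T.Leaf) (I : N → V → Formula S)
    (C : Clause S) (J : V → Formula S) : Rule S T.Leaf N → Prop
  | .input p => ∀ v, J v = attributed colour p (T.st v) C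
  | .inst Q _ => ∀ v, J v = attributed colour (colour (.proxy Q)) (T.st v) C
  | .trans _ t steps d => ∀ v, J v = transInterp colour (T.st v) t steps d
  | .cong f _ _ => ∃ p ∈ partitions F f, ∀ v, J v = attributed colour p (T.st v) C
  | .trich _ _ => ∀ v, J v = kernel colour (T.st v) C ∨ J v = .neg (kernel colour (T.st v)ᶜ C)
  | .farkas rows => ∀ v, J v = farkasInterp colour (T.st v) rows
  | .res j k l => RemoveAll T F C (combine T colour l (I j) (I k)) J

/-- `I` is a possible outcome of the algorithm: a labelling of the nodes of the proof graph, each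
node with a labelling of the tree, that results from the rules. -/
def ResProof.IsRun {T : InterpTree V} {K : T.Leaf → CNF S} (π : ResProof K)
    (colour : PAtom S → T.Leaf) (I : Fin π.size → V → Formula S) : Prop :=
  ∀ i, (π.rule i).Computes T (fun p => cnfFormula (K p)) colour I (π.clause i) (I i)

end Algorithm

end

end TreeInterp

open TreeInterp

/-! The proof carries an invariant through the resolution DAG. For a node with clause `C`, its
labels satisfy `IsPartialInterpolant`: they behave like a tree interpolant when each leaf `p` may
use, besides its input, the flattened negations of the literals of `C` coloured `p` and the
flattening equalities `v_{f(t₁,…,tₙ)} = f(v_{t₁},…,v_{tₙ})` for those `f` that belong to `p`. The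
root and inner conditions hold for every assignment, without flattening equalities. In addition
every free variable of a label is supported by `C` (`FlatFree`). For the empty clause nothing is
supported, so the labels are closed, and the assignment `v_t ↦` value of `t` satisfies all
flattening equalities: the invariant becomes the theorem.

For the leaves of the DAG, input, instantiation and congruence clauses are all consequences of a
single partition `q` modulo its flattening equalities, and one argument
(`isPartialInterpolant_attributed`) covers them. Trichotomy works because exactly one of the three
literals is true. Farkas labels are partial sums that add up over disjoint subtrees. Transitivity
labels say that each maximal block of links coloured in `A` has equal end points, and blocks of
disjoint sets concatenate (`blocksEqual_union`).

In a resolution step the disjunction or conjunction is justified by a case split on the pivot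
(`IsPartialInterpolant.combine`). The delicate point is variable removal
(`IsPartialInterpolant.removeStep`). At an inner node, either both labels hold at the common value
`f(v_{t₁},…,v_{tₙ})`, or an existential witness on one side meets a universal statement on the
other, or both sides are universal (`removed_inner`). At a leaf whose input lacks `f`, the value of
`v_t` can be changed freely, provided that the values of all terms containing `t` are recomputed.
This disturbs neither the label nor the literals of `C`, because `t` is outermost and unsupported
(`flatEq_recomputeAssign`). Symbols enter labels only by the third kind of removal, where `f` occurs
on both sides of the cut.

Removal terminates because the total size of the terms `t` with `v_t` free drops at each step
(`freeWeight_lt`), and an unsupported term of maximal size is always an admissible choice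
(`exists_removeStep`). -/

namespace TreeInterp

open Set Relation
open scoped Classical

noncomputable section

variable {S : Signature} {V : Type}

/-! ## Terms -/

section Terms

variable {X Y : Srt S.USort → Type}

theorem Term.eval_subst (M : Model S) (σ : ∀ x : (Σ s, X s), Term S Y x.1) (ρ : Assign M Y)
    {s : Srt S.USort} (t : Term S X s) :
    (t.subst σ).eval M ρ = t.eval M (fun x => (σ x).eval M ρ) := by
  induction t with
  | var x => rfl
  | app f args ih => simp only [Term.subst, Term.eval, ih]

theorem Term.eval_congr (M : Model S) {ρ ρ' : Assign M X} {s : Srt S.USort} (t : Term S X s)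
    (h : ∀ x ∈ t.vars, ρ x = ρ' x) : t.eval M ρ = t.eval M ρ' := by
  induction t with
  | var x => exact h _ rfl
  | app f args ih =>
    simp only [Term.eval]
    congr 1
    funext i
    exact ih i fun x hx => h x (mem_iUnion.2 ⟨i, hx⟩)

theorem Term.vars_subst_subset (σ : ∀ x : (Σ s, X s), Term S Y x.1) {s : Srt S.USort}
    (t : Term S X s) : (t.subst σ).vars ⊆ ⋃ x ∈ t.vars, (σ x).vars := by
  induction t with
  | var x => exact fun y hy => mem_iUnion₂.2 ⟨⟨_, x⟩, rfl, hy⟩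
  | app f args ih =>
    intro y hy
    obtain ⟨i, hi⟩ := mem_iUnion.1 hy
    obtain ⟨x, hx, hxy⟩ := mem_iUnion₂.1 (ih i hi)
    exact mem_biUnion (mem_iUnion.2 ⟨i, hx⟩) hxy

theorem Term.syms_subst_subset (σ : ∀ x : (Σ s, X s), Term S Y x.1) {s : Srt S.USort}
    (t : Term S X s) : (t.subst σ).syms ⊆ t.syms ∪ ⋃ x ∈ t.vars, (σ x).syms := by
  induction t with
  | var x => exact fun y hy => .inr (mem_iUnion₂.2 ⟨⟨_, x⟩, rfl, hy⟩)
  | app f args ih =>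
    rintro y (hy | hy)
    · exact .inl (.inl hy)
    · obtain ⟨i, hi⟩ := mem_iUnion.1 hy
      rcases ih i hi with h | h
      · exact .inl (.inr (mem_iUnion.2 ⟨i, h⟩))
      · obtain ⟨x, hx, hxy⟩ := mem_iUnion₂.1 h
        exact .inr (mem_biUnion (mem_iUnion.2 ⟨i, hx⟩) hxy)

theorem Term.syms_subset_subst (σ : ∀ x : (Σ s, X s), Term S Y x.1) {s : Srt S.USort}
    (t : Term S X s) : t.syms ⊆ (t.subst σ).syms := by
  induction t with
  | var x => exact empty_subset _
  | app f args ih =>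
    rintro y (hy | hy)
    · exact .inl hy
    · obtain ⟨i, hi⟩ := mem_iUnion.1 hy
      exact .inr (mem_iUnion.2 ⟨i, ih i hi⟩)

/-- The head symbol and the arguments of a term. -/
def Term.head? : {s : Srt S.USort} → Term S X s →
    Option (Σ f : Sym S, ∀ i : Fin f.dom.length, Term S X (f.dom.get i))
  | _, .var _ => none
  | _, .app f args => some ⟨f, args⟩

/-- Distinct symbols may have the same value sort, so the equation is read off through `Term.head?`
instead of by cases on `f.cod = g.cod`. -/
theorem Term.app_inj {f g : Sym S} {a : ∀ i : Fin f.dom.length, Term S X (f.dom.get i)}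
    {b : ∀ i : Fin g.dom.length, Term S X (g.dom.get i)}
    (h : (⟨_, .app f a⟩ : Σ s, Term S X s) = ⟨_, .app g b⟩) :
    (⟨f, a⟩ : Σ f : Sym S, ∀ i : Fin f.dom.length, Term S X (f.dom.get i)) = ⟨g, b⟩ :=
  Option.some.inj (congrArg (fun x : Σ s, Term S X s => x.2.head?) h)

theorem GTerm.subst_sigma_injective (σ : ∀ x : (Σ s, NoVar S s), Term S Y x.1)
    {s : Srt S.USort} (t : GTerm S s) : ∀ {s' : Srt S.USort} (u : GTerm S s'),
    (⟨s, t.subst σ⟩ : Σ s, Term S Y s) = ⟨s', u.subst σ⟩ →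
    (⟨s, t⟩ : Σ s, GTerm S s) = ⟨s', u⟩ := by
  induction t with
  | var x => exact x.elim
  | app f a ih =>
    intro s' u h
    cases u with
    | var x => exact x.elim
    | app g b =>
      have h' := Term.app_inj h
      obtain rfl : f = g := congrArg Sigma.fst h'
      have h'' := eq_of_heq (Sigma.mk.inj h').2
      have : a = b := by
        funext i
        exact eq_of_heq (Sigma.mk.inj (ih i (b i) (by rw [congrFun h'' i]))).2
      rw [this]

theorem GTerm.subst_injective (σ : ∀ x : (Σ s, NoVar S s), Term S Y x.1) {s : Srt S.USort} :
    Function.Injective (fun t : GTerm S s => t.subst σ) := fun t u h =>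
  eq_of_heq (Sigma.mk.inj (GTerm.subst_sigma_injective σ t u (by
    simp only at h; rw [h]))).2

/-- The number of symbols of a term. -/
def Term.size : {s : Srt S.USort} → Term S X s → ℕ
  | _, .var _ => 1
  | _, .app _ args => 1 + ∑ i, (args i).size

end Terms

theorem Subterm.trans {s s' s'' : Srt S.USort} {t : GTerm S s} {u : GTerm S s'}
    {w : GTerm S s''} (h : Subterm t u) (h' : Subterm u w) : Subterm t w := by
  induction h' with
  | refl => exact h
  | arg f args i _ ih => exact .arg f args i ih

theorem Subterm.size_le {s s' : Srt S.USort} {t : GTerm S s} {u : GTerm S s'}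
    (h : Subterm t u) : t.size ≤ u.size := by
  induction h with
  | refl => rfl
  | arg f args i _ ih =>
    have := Finset.single_le_sum (f := fun i => (args i).size) (fun _ _ => Nat.zero_le _)
      (Finset.mem_univ i)
    simp only [Term.size] at *
    omega

theorem Subterm.syms_subset {s s' : Srt S.USort} {t : GTerm S s} {u : GTerm S s'}
    (h : Subterm t u) : t.syms ⊆ u.syms := by
  induction h with
  | refl => exact Subset.rfl
  | arg f args i _ ih => exact fun g hg => .inr (mem_iUnion.2 ⟨i, ih hg⟩)

theorem ProperSubterm.subterm {s s' : Srt S.USort} {t : GTerm S s} {u : GTerm S s'}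
    (h : ProperSubterm t u) : Subterm t u := by
  obtain ⟨f, args, i, h, e⟩ := h
  cases e
  exact (Subterm.arg f args i .refl).trans h

theorem ProperSubterm.size_lt {s s' : Srt S.USort} {t : GTerm S s} {u : GTerm S s'}
    (h : ProperSubterm t u) : t.size < u.size := by
  obtain ⟨f, args, i, h, e⟩ := h
  cases e
  have := Finset.single_le_sum (f := fun i => (args i).size) (fun _ _ => Nat.zero_le _)
      (Finset.mem_univ i)
  have := h.size_le
  simp only [Term.size] at *
  omega

theorem ProperSubterm.arg {s : Srt S.USort} {t : GTerm S s} {f : Sym S}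
    {args : ∀ i : Fin f.dom.length, GTerm S (f.dom.get i)} (i : Fin f.dom.length)
    (h : ProperSubterm t (args i)) : ProperSubterm t (.app f args) := by
  obtain ⟨g, b, j, h, e⟩ := h
  exact ⟨g, b, j, .arg f args i h, e⟩

theorem Supported.subterm {C : Clause S} {s s' : Srt S.USort} {t : GTerm S s} {u : GTerm S s'}
    (hu : Supported C u) (h : Subterm t u) : Supported C t := by
  obtain ⟨l, hl, a, ha, w, hw, huw⟩ := hu
  exact ⟨l, hl, a, ha, w, hw, h.trans huw⟩

/-! ## Atoms -/

section Atoms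

variable {X Y : Srt S.USort → Type}

theorem Atom.holds_congr (M : Model S) {e e' : ∀ s : Srt S.USort, Term S X s → M.Dom s}
    (a : Atom S X) (h : ∀ t ∈ a.terms, e t.1 t.2 = e' t.1 t.2) : a.Holds M e ↔ a.Holds M e' := by
  cases a with
  | eq t u =>
    simp only [Atom.Holds, h ⟨_, t⟩ (.inl rfl), h ⟨_, u⟩ (.inr rfl)]
  | le L c =>
    simp only [Atom.Holds]
    rw [Finsupp.sum_congr]
    intro t ht
    rw [h ⟨_, t⟩ ⟨t, ht, rfl⟩]

theorem Atom.holds_subst (M : Model S) (σ : ∀ x : (Σ s, X s), Term S Y x.1)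
    (e : ∀ s : Srt S.USort, Term S Y s → M.Dom s) (a : Atom S X) :
    (a.subst σ).Holds M e ↔ a.Holds M (fun s t => e s (t.subst σ)) := by
  cases a with
  | eq t u => rfl
  | le L c =>
    simp only [Atom.Holds, Atom.subst]
    rw [Finsupp.sum_mapDomain_index (fun _ => zero_mul _) (fun _ _ _ => add_mul _ _ _)]

theorem Atom.eval_subst (M : Model S) (σ : ∀ x : (Σ s, X s), Term S Y x.1) (ρ : Assign M Y)
    (a : Atom S X) : (a.subst σ).eval M ρ ↔ a.eval M (fun x => (σ x).eval M ρ) := by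
  unfold Atom.eval
  rw [Atom.holds_subst]
  exact Atom.holds_congr M a fun t _ => Term.eval_subst M σ ρ t.2

theorem Atom.eval_congr (M : Model S) {ρ ρ' : Assign M X} (a : Atom S X)
    (h : ∀ x ∈ a.vars, ρ x = ρ' x) : a.eval M ρ ↔ a.eval M ρ' :=
  Atom.holds_congr M a fun t ht => Term.eval_congr M t.2 fun x hx => h x (mem_biUnion ht hx)

theorem Atom.terms_subst_subset (σ : ∀ x : (Σ s, X s), Term S Y x.1) (a : Atom S X) :
    (a.subst σ).terms ⊆ (fun t => ⟨t.1, t.2.subst σ⟩) '' a.terms := by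
  cases a with
  | eq t u =>
    rintro _ (rfl | rfl)
    · exact ⟨⟨_, t⟩, .inl rfl, rfl⟩
    · exact ⟨⟨_, u⟩, .inr rfl, rfl⟩
  | le L c =>
    rintro _ ⟨t, ht, rfl⟩
    obtain ⟨u, hu, rfl⟩ := Finset.mem_image.1 (Finsupp.mapDomain_support ht)
    exact ⟨⟨_, u⟩, ⟨u, hu, rfl⟩, rfl⟩

theorem Atom.vars_subst_subset (σ : ∀ x : (Σ s, X s), Term S Y x.1) (a : Atom S X) :
    (a.subst σ).vars ⊆ ⋃ x ∈ a.vars, (σ x).vars := by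
  intro y hy
  obtain ⟨t, ht, hy⟩ := mem_iUnion₂.1 hy
  obtain ⟨u, hu, rfl⟩ := Atom.terms_subst_subset σ a ht
  obtain ⟨x, hx, hy⟩ := mem_iUnion₂.1 (Term.vars_subst_subset σ u.2 hy)
  exact mem_biUnion (mem_biUnion hu hx) hy

theorem Atom.syms_subst_subset (σ : ∀ x : (Σ s, X s), Term S Y x.1) (a : Atom S X) :
    (a.subst σ).syms ⊆ a.syms ∪ ⋃ x ∈ a.vars, (σ x).syms := by
  intro y hy
  obtain ⟨t, ht, hy⟩ := mem_iUnion₂.1 hy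
  obtain ⟨u, hu, rfl⟩ := Atom.terms_subst_subset σ a ht
  rcases Term.syms_subst_subset σ u.2 hy with hy | hy
  · exact .inl (mem_biUnion hu hy)
  · obtain ⟨x, hx, hy⟩ := mem_iUnion₂.1 hy
    exact .inr (mem_biUnion (mem_biUnion hu hx) hy)

/-- The only danger is cancellation of coefficients when terms of a linear combination are
identified; substitution into ground terms is injective, so none occurs. -/
theorem Atom.syms_subset_subst_ground (σ : ∀ x : (Σ s, NoVar S s), Term S Y x.1)
    (a : Atom S (NoVar S)) : a.syms ⊆ (a.subst σ).syms := by
  have key : ∀ t ∈ a.terms, (⟨t.1, t.2.subst σ⟩ : Σ s, Term S Y s) ∈ (a.subst σ).terms := by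
    cases a with
    | eq t u =>
      rintro _ (rfl | rfl)
      · exact .inl rfl
      · exact .inr rfl
    | le L c =>
      rintro _ ⟨t, ht, rfl⟩
      refine ⟨t.subst σ, ?_, rfl⟩
      rw [Finsupp.mapDomain_support_of_injective (GTerm.subst_injective σ)]
      exact Finset.mem_image_of_mem _ ht
  intro g hg
  obtain ⟨t, ht, hg⟩ := mem_iUnion₂.1 hg
  exact mem_biUnion (key t ht) (Term.syms_subset_subst σ t.2 hg)

theorem Term.vars_finite {s : Srt S.USort} (t : Term S X s) : t.vars.Finite := by
  induction t with
  | var x => exact finite_singleton _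
  | app f args ih => exact finite_iUnion ih

theorem Atom.vars_finite (a : Atom S X) : a.vars.Finite := by
  refine Finite.biUnion ?_ fun t _ => t.2.vars_finite
  cases a with
  | eq t u => exact (finite_singleton _).insert _
  | le L c =>
    refine (L.support.finite_toSet.image fun t => (⟨_, t⟩ : Σ s, Term S X s)).subset ?_
    rintro _ ⟨t, ht, rfl⟩
    exact ⟨t, ht, rfl⟩

end Atoms

/-! ## Formulas -/

theorem Formula.free_subset_occ (φ : Formula S) : φ.free ⊆ φ.occ := by
  induction φ with
  | top | bot | atom | qclause => exact Subset.rfl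
  | neg φ ih => exact ih
  | and φ ψ ih ih' => exact union_subset_union ih ih'
  | or φ ψ ih ih' => exact union_subset_union ih ih'
  | all s n φ ih => exact fun x hx => .inr (ih hx.1)
  | ex s n φ ih => exact fun x hx => .inr (ih hx.1)

theorem Formula.occ_finite (φ : Formula S) : φ.occ.Finite := by
  induction φ with
  | top | bot | qclause => exact finite_empty
  | atom a => exact a.vars_finite
  | neg φ ih => exact ih
  | and φ ψ ih ih' => exact ih.union ih'
  | or φ ψ ih ih' => exact ih.union ih'
  | all s n φ ih => exact ih.insert _
  | ex s n φ ih => exact ih.insert _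

theorem Formula.fresh_notMem_occ (φ : Formula S) (s : Srt S.USort) :
    (⟨s, .bnd (φ.fresh s)⟩ : Σ s, Var S s) ∉ φ.occ := by
  have h : {n | (⟨s, .bnd n⟩ : Σ s, Var S s) ∉ φ.occ}.Nonempty := by
    have hinj : Function.Injective (fun n : ℕ => (⟨s, .bnd n⟩ : Σ s, Var S s)) := by
      intro m n h
      simpa using h
    have := (φ.occ_finite.preimage hinj.injOn).infinite_compl.nonempty
    exact this
  exact Nat.sInf_mem h

theorem Formula.eval_congr (M : Model S) (φ : Formula S) : ∀ {ρ ρ' : Assign M (Var S)},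
    (∀ x ∈ φ.free, ρ x = ρ' x) → (φ.eval M ρ ↔ φ.eval M ρ') := by
  have upd : ∀ (φ : Formula S) (y : Σ s, Var S s) (d : M.Dom y.1) (ρ ρ' : Assign M (Var S)),
      (∀ x ∈ φ.free \ {y}, ρ x = ρ' x) →
      ∀ x ∈ φ.free, (Function.update ρ y d : Assign M (Var S)) x =
        (Function.update ρ' y d : Assign M (Var S)) x := by
    intro φ y d ρ ρ' h x hx
    by_cases hxy : x = y
    · subst hxy; simp
    · rw [Function.update_of_ne hxy, Function.update_of_ne hxy]
      exact h x ⟨hx, hxy⟩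
  induction φ with
  | top | bot | qclause => intros; rfl
  | atom a => exact fun h => a.eval_congr M h
  | neg φ ih => exact fun h => not_congr (ih h)
  | and φ ψ ih ih' =>
    exact fun h => and_congr (ih fun x hx => h x (.inl hx)) (ih' fun x hx => h x (.inr hx))
  | or φ ψ ih ih' =>
    exact fun h => or_congr (ih fun x hx => h x (.inl hx)) (ih' fun x hx => h x (.inr hx))
  | all s n φ ih => exact fun h => forall_congr' fun d => ih (upd φ _ d _ _ h)
  | ex s n φ ih => exact fun h => exists_congr fun d => ih (upd φ _ d _ _ h)

theorem replaceVar_self {s : Srt S.USort} (t : GTerm S s) (r : Term S (Var S) s) :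
    replaceVar t r ⟨s, .flat t⟩ = r := Function.update_self ..

theorem replaceVar_of_ne {s : Srt S.USort} (t : GTerm S s) (r : Term S (Var S) s)
    {x : Σ s, Var S s} (h : x ≠ ⟨s, .flat t⟩) : replaceVar t r x = .var x.2 :=
  Function.update_of_ne h ..

theorem eval_replaceVar (M : Model S) {s : Srt S.USort} (t : GTerm S s) (r : Term S (Var S) s)
    (ρ : Assign M (Var S)) : (fun x => (replaceVar t r x).eval M ρ) =
      Function.update ρ ⟨s, .flat t⟩ (r.eval M ρ) := by
  funext x
  by_cases h : x = ⟨s, .flat t⟩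
  · subst h; rw [replaceVar_self, Function.update_self]
  · rw [replaceVar_of_ne t r h, Function.update_of_ne h]; rfl

/-- The variable `x` is bound somewhere in the formula. -/
def Formula.Binds (x : Σ s, Var S s) : Formula S → Prop
  | .top | .bot | .atom _ | .qclause _ => False
  | .neg φ => φ.Binds x
  | .and φ ψ | .or φ ψ => φ.Binds x ∨ ψ.Binds x
  | .all s n φ | .ex s n φ => x = ⟨s, .bnd n⟩ ∨ φ.Binds x

theorem Formula.Binds.mem_occ {x : Σ s, Var S s} {φ : Formula S} (h : φ.Binds x) :
    x ∈ φ.occ := by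
  induction φ with
  | top | bot | qclause | atom => exact h.elim
  | neg φ ih => exact ih h
  | and φ ψ ih ih' | or φ ψ ih ih' => exact h.imp ih ih'
  | all s n φ ih | ex s n φ ih => exact h.imp id ih

theorem Formula.Binds.ne_flat {s : Srt S.USort} {t : GTerm S s} {φ : Formula S} :
    ¬ φ.Binds ⟨s, .flat t⟩ := by
  have key : ∀ s' n, (⟨s, .flat t⟩ : Σ s, Var S s) ≠ ⟨s', .bnd n⟩ := by
    intro s' n h
    cases h
  induction φ with
  | top | bot | qclause | atom => exact id
  | neg φ ih => exact ih
  | and φ ψ ih ih' | or φ ψ ih ih' => exact fun h => h.elim ih ih'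
  | all s n φ ih | ex s n φ ih => exact fun h => h.elim (key _ _) ih

/-- Under a binder the two updates commute: the bound variable is not a flattening variable, and by
hypothesis it does not occur in `r`, so the value of `r` is unchanged there. -/
theorem Formula.eval_replace (M : Model S) {s : Srt S.USort} (t : GTerm S s)
    (r : Term S (Var S) s) (φ : Formula S) : ∀ (ρ : Assign M (Var S)),
    (∀ x ∈ r.vars, ¬ φ.Binds x) →
    ((φ.replace t r).eval M ρ ↔ φ.eval M (Function.update ρ ⟨s, .flat t⟩ (r.eval M ρ))) := by
  have upd : ∀ (s' : Srt S.USort) (n : ℕ) (d : M.Dom s') (ρ : Assign M (Var S)),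
      (∀ x ∈ r.vars, x ≠ ⟨s', .bnd n⟩) →
      (Function.update (Function.update ρ ⟨s', .bnd n⟩ d) ⟨s, .flat t⟩
        (r.eval M (Function.update ρ ⟨s', .bnd n⟩ d)) : Assign M (Var S)) =
      Function.update (Function.update ρ ⟨s, .flat t⟩ (r.eval M ρ)) ⟨s', .bnd n⟩ d := by
    intro s' n d ρ h
    rw [Function.update_comm (by intro h; cases h)]
    congr 2
    exact Term.eval_congr M r fun x hx => Function.update_of_ne (h x hx) ..
  induction φ with
  | top | bot | qclause => intros; rfl
  | atom a =>
    intro ρ _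
    simp only [Formula.replace, Formula.eval]
    rw [Atom.eval_subst, eval_replaceVar]
  | neg φ ih => exact fun ρ h => not_congr (ih ρ h)
  | and φ ψ ih ih' =>
    exact fun ρ h => and_congr (ih ρ fun x hx hb => h x hx (.inl hb))
      (ih' ρ fun x hx hb => h x hx (.inr hb))
  | or φ ψ ih ih' =>
    exact fun ρ h => or_congr (ih ρ fun x hx hb => h x hx (.inl hb))
      (ih' ρ fun x hx hb => h x hx (.inr hb))
  | all s' n φ ih =>
    intro ρ h
    refine forall_congr' fun d => ?_
    rw [ih _ fun x hx hb => h x hx (.inr hb), upd _ _ _ _ fun x hx e => h x hx (.inl e)]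
  | ex s' n φ ih =>
    intro ρ h
    refine exists_congr fun d => ?_
    rw [ih _ fun x hx hb => h x hx (.inr hb), upd _ _ _ _ fun x hx e => h x hx (.inl e)]

theorem Formula.free_replace_subset {s : Srt S.USort} (t : GTerm S s) (r : Term S (Var S) s)
    (φ : Formula S) : (φ.replace t r).free ⊆ (φ.free \ {⟨s, .flat t⟩}) ∪ r.vars := by
  induction φ with
  | top | bot | qclause => exact empty_subset _
  | atom a =>
    intro y hy
    obtain ⟨x, hx, hy⟩ := mem_iUnion₂.1 (Atom.vars_subst_subset _ a hy)
    by_cases h : x = ⟨s, .flat t⟩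
    · subst h
      rw [replaceVar_self] at hy
      exact .inr hy
    · rw [replaceVar_of_ne t r h] at hy
      obtain rfl : y = x := hy
      exact .inl ⟨hx, h⟩
  | neg φ ih => exact ih
  | and φ ψ ih ih' | or φ ψ ih ih' =>
    rintro x (hx | hx)
    · exact (ih hx).imp (fun h => ⟨.inl h.1, h.2⟩) id
    · exact (ih' hx).imp (fun h => ⟨.inr h.1, h.2⟩) id
  | all s n φ ih | ex s n φ ih =>
    rintro x ⟨hx, hn⟩
    exact (ih hx).imp (fun h => ⟨⟨h.1, hn⟩, h.2⟩) id

theorem Formula.syms_replace_subset {s : Srt S.USort} (t : GTerm S s) (r : Term S (Var S) s)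
    (φ : Formula S) : (φ.replace t r).syms ⊆ φ.syms ∪ r.syms := by
  induction φ with
  | top | bot => exact empty_subset _
  | qclause => exact subset_union_left
  | atom a =>
    intro y hy
    rcases Atom.syms_subst_subset _ a hy with hy | hy
    · exact .inl hy
    obtain ⟨x, hx, hy⟩ := mem_iUnion₂.1 hy
    by_cases h : x = ⟨s, .flat t⟩
    · subst h
      rw [replaceVar_self] at hy
      exact .inr hy
    · rw [replaceVar_of_ne t r h] at hy
      exact hy.elim
  | neg φ ih | all s n φ ih | ex s n φ ih => exact ih
  | and φ ψ ih ih' | or φ ψ ih ih' =>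
    rintro x (hx | hx)
    · exact (ih hx).imp .inl id
    · exact (ih' hx).imp .inr id

theorem Formula.eval_conj (M : Model S) (ρ : Assign M (Var S)) (l : List (Formula S)) :
    (Formula.conj l).eval M ρ ↔ ∀ φ ∈ l, φ.eval M ρ := by
  induction l with
  | nil => simp [Formula.conj, Formula.eval]
  | cons φ l ih =>
    rw [List.forall_mem_cons, ← ih]
    rfl

theorem Formula.eval_disj (M : Model S) (ρ : Assign M (Var S)) (l : List (Formula S)) :
    (Formula.disj l).eval M ρ ↔ ∃ φ ∈ l, φ.eval M ρ := by
  induction l with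
  | nil => simp [Formula.disj, Formula.eval]
  | cons φ l ih =>
    rw [List.exists_mem_cons_iff, ← ih]
    rfl

theorem Formula.syms_conj (l : List (Formula S)) :
    (Formula.conj l).syms = ⋃ φ ∈ l, φ.syms := by
  induction l with
  | nil => simp [Formula.conj, Formula.syms]
  | cons φ l ih =>
    change φ.syms ∪ (Formula.conj l).syms = _
    rw [ih]
    simp

theorem Formula.syms_disj (l : List (Formula S)) :
    (Formula.disj l).syms = ⋃ φ ∈ l, φ.syms := by
  induction l with
  | nil => simp [Formula.disj, Formula.syms]
  | cons φ l ih =>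
    change φ.syms ∪ (Formula.disj l).syms = _
    rw [ih]
    simp

theorem Formula.free_conj (l : List (Formula S)) :
    (Formula.conj l).free = ⋃ φ ∈ l, φ.free := by
  induction l with
  | nil => simp [Formula.conj, Formula.free]
  | cons φ l ih =>
    change φ.free ∪ (Formula.conj l).free = _
    rw [ih]
    simp

theorem Formula.eval_signed (M : Model S) (ρ : Assign M (Var S)) (b : Bool) (φ : Formula S) :
    (Formula.signed b φ).eval M ρ ↔ (φ.eval M ρ ↔ b = true) := by
  cases b <;> simp [Formula.signed, Formula.eval]

theorem Formula.syms_signed (b : Bool) (φ : Formula S) :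
    (Formula.signed b φ).syms = φ.syms := by
  cases b <;> rfl

theorem Formula.free_signed (b : Bool) (φ : Formula S) :
    (Formula.signed b φ).free = φ.free := by
  cases b <;> rfl

/-! ## Truth of ground clauses -/

/-- The value of a ground term. -/
def GTerm.value (M : Model S) (s : Srt S.USort) (t : GTerm S s) : M.Dom s :=
  t.eval M (fun x => x.2.elim)

/-- Truth of a ground or proxy atom when `e` gives the values of the ground terms. -/
def PAtom.Holds (M : Model S) (e : ∀ s : Srt S.USort, GTerm S s → M.Dom s) : PAtom S → Prop
  | .base a => a.Holds M e
  | .proxy Q => ∀ τ : Assign M (QVar S), ∃ l ∈ Q, (l.atom.eval M τ ↔ l.pos = true)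

/-- Truth of a literal when `e` gives the values of the ground terms. -/
def Lit.Holds (M : Model S) (e : ∀ s : Srt S.USort, GTerm S s → M.Dom s) (l : Lit (PAtom S)) :
    Prop := l.atom.Holds M e ↔ l.pos = true

theorem PAtom.eval_toFormula (M : Model S) (ρ : Assign M (Var S)) (a : PAtom S) :
    a.toFormula.eval M ρ ↔ a.Holds M (GTerm.value M) := by
  cases a with
  | proxy Q => rfl
  | base a =>
    simp only [PAtom.toFormula, Formula.eval, Atom.eval_subst]
    exact Atom.holds_congr M a fun t _ => Term.eval_congr M t.2 fun x _ => x.2.elim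

theorem eval_clauseFormula (M : Model S) (ρ : Assign M (Var S)) (C : Clause S) :
    (clauseFormula C).eval M ρ ↔ ∃ l ∈ C, l.Holds M (GTerm.value M) := by
  simp [clauseFormula, Formula.eval_disj, Formula.eval_signed, PAtom.eval_toFormula, Lit.Holds]

theorem eval_cnfFormula (M : Model S) (ρ : Assign M (Var S)) (K : CNF S) :
    (cnfFormula K).eval M ρ ↔ ∀ C ∈ K, ∃ l ∈ C, l.Holds M (GTerm.value M) := by
  simp [cnfFormula, Formula.eval_conj, eval_clauseFormula]

theorem base_syms_subset_clauseFormula {C : Clause S} {l : Lit (PAtom S)} (hl : l ∈ C)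
    {a : Atom S (NoVar S)} (ha : l.atom = .base a) : a.syms ⊆ (clauseFormula C).syms := by
  intro g hg
  rw [clauseFormula, Formula.syms_disj]
  refine mem_biUnion (List.mem_map_of_mem hl) ?_
  rw [Formula.syms_signed, ha]
  exact Atom.syms_subset_subst_ground _ a hg

theorem proxy_syms_subset_clauseFormula {C : Clause S} {l : Lit (PAtom S)} (hl : l ∈ C)
    {Q : QClause S} (ha : l.atom = .proxy Q) {l' : Lit (Atom S (QVar S))} (hl' : l' ∈ Q) :
    l'.atom.syms ⊆ (clauseFormula C).syms := by
  intro g hg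
  rw [clauseFormula, Formula.syms_disj]
  refine mem_biUnion (List.mem_map_of_mem hl) ?_
  rw [Formula.syms_signed, ha]
  exact ⟨l', hl', hg⟩

theorem clauseFormula_syms_subset_cnfFormula {K : CNF S} {C : Clause S} (h : C ∈ K) :
    (clauseFormula C).syms ⊆ (cnfFormula K).syms := by
  intro g hg
  rw [cnfFormula, Formula.syms_conj]
  exact mem_biUnion (List.mem_map_of_mem h) hg

/-! ## Flattening -/

/-- The values that an assignment gives to the ground terms through the flattening variables. -/
def flatValue (M : Model S) (ρ : Assign M (Var S)) (s : Srt S.USort) (t : GTerm S s) :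
    M.Dom s := ρ ⟨s, .flat t⟩

theorem holds_flatLin (M : Model S) (ρ : Assign M (Var S)) (L : GTerm S .rat →₀ ℚ) (c : ℚ) :
    (Atom.le (flatLin L) c).eval M ρ ↔ (Atom.le L c : Atom S (NoVar S)).Holds M (flatValue M ρ) := by
  simp only [Atom.eval, Atom.Holds, flatLin]
  rw [Finsupp.sum_mapDomain_index (fun _ => zero_mul _) (fun _ _ _ => add_mul _ _ _)]
  rfl

theorem PAtom.eval_flatten (M : Model S) (ρ : Assign M (Var S)) (a : PAtom S) :
    a.flatten.eval M ρ ↔ a.Holds M (flatValue M ρ) := by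
  cases a with
  | proxy Q => rfl
  | base a =>
    cases a with
    | eq t u => rfl
    | le L c => exact holds_flatLin M ρ L c

theorem Lit.holds_neg (M : Model S) (e : ∀ s : Srt S.USort, GTerm S s → M.Dom s)
    (l : Lit (PAtom S)) : l.neg.Holds M e ↔ ¬ l.Holds M e := by
  obtain ⟨b, a⟩ := l
  cases b <;> simp [Lit.neg, Lit.Holds]

theorem eval_flattenLit (M : Model S) (ρ : Assign M (Var S)) (l : Lit (PAtom S)) :
    (flattenLit l).eval M ρ ↔ l.Holds M (flatValue M ρ) := by
  rw [flattenLit, Formula.eval_signed, PAtom.eval_flatten, Lit.Holds]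

theorem mem_terms_flatLin {L : GTerm S .rat →₀ ℚ} {c : ℚ} {x : Σ s, Term S (Var S) s}
    (hx : x ∈ (Atom.le (flatLin L) c).terms) : ∃ t ∈ L.support, x = ⟨_, flatVar t⟩ := by
  obtain ⟨t, ht, rfl⟩ := hx
  obtain ⟨u, hu, rfl⟩ := Finset.mem_image.1 (Finsupp.mapDomain_support ht)
  exact ⟨u, hu, rfl⟩

theorem syms_flatLin (L : GTerm S .rat →₀ ℚ) (c : ℚ) : (Atom.le (flatLin L) c).syms = ∅ := by
  refine eq_empty_of_forall_notMem fun g hg => ?_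
  obtain ⟨x, hx, hg⟩ := mem_iUnion₂.1 hg
  obtain ⟨t, -, rfl⟩ := mem_terms_flatLin hx
  exact hg

theorem vars_flatLin {L : GTerm S .rat →₀ ℚ} {c : ℚ} {y : Σ s, Var S s}
    (hy : y ∈ (Atom.le (flatLin L) c).vars) : ∃ t ∈ L.support, y = ⟨_, .flat t⟩ := by
  obtain ⟨x, hx, hg⟩ := mem_iUnion₂.1 hy
  obtain ⟨t, ht, rfl⟩ := mem_terms_flatLin hx
  exact ⟨t, ht, hg⟩

theorem syms_eq_flatVar {s : Srt S.USort} (t u : GTerm S s) :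
    (Atom.eq (flatVar t) (flatVar u)).syms = ∅ := by
  refine eq_empty_of_forall_notMem fun g hg => ?_
  obtain ⟨x, rfl | rfl, hg⟩ := mem_iUnion₂.1 hg <;> exact hg

theorem vars_eq_flatVar {s : Srt S.USort} {t u : GTerm S s} {y : Σ s, Var S s}
    (hy : y ∈ (Atom.eq (flatVar t) (flatVar u)).vars) :
    y = ⟨s, .flat t⟩ ∨ y = ⟨s, .flat u⟩ := by
  obtain ⟨x, rfl | rfl, hg⟩ := mem_iUnion₂.1 hy
  · exact .inl hg
  · exact .inr hg

theorem PAtom.syms_flatten_base (a : Atom S (NoVar S)) : (PAtom.base a).flatten.syms = ∅ := by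
  cases a with
  | eq t u => exact syms_eq_flatVar t u
  | le L c => exact syms_flatLin L c

theorem PAtom.free_flatten {a : PAtom S} {y : Σ s, Var S s} (hy : y ∈ a.flatten.free) :
    ∃ b, a = .base b ∧ ∃ t ∈ b.terms, y = ⟨t.1, .flat t.2⟩ := by
  cases a with
  | proxy Q => exact hy.elim
  | base a =>
    refine ⟨a, rfl, ?_⟩
    cases a with
    | eq t u =>
      rcases vars_eq_flatVar hy with h | h
      · exact ⟨⟨_, t⟩, .inl rfl, h⟩
      · exact ⟨⟨_, u⟩, .inr rfl, h⟩
    | le L c =>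
      obtain ⟨t, ht, h⟩ := vars_flatLin hy
      exact ⟨⟨_, t⟩, ⟨t, ht, rfl⟩, h⟩

/-! ### Kernels of negated clauses: truth, symbols and free variables -/

section Kernel

variable {P : Type} (colour : PAtom S → P)

theorem eval_kernel (M : Model S) (ρ : Assign M (Var S)) (A : Set P) (C : Clause S) :
    (kernel colour A C).eval M ρ ↔
      ∀ l ∈ C, colour l.atom ∈ A → ¬ l.Holds M (flatValue M ρ) := by
  simp only [kernel, Formula.eval_conj, List.forall_mem_map, List.mem_filter, decide_eq_true_eq,
    eval_flattenLit, Lit.holds_neg, and_imp]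

/-- Flattened ground atoms contain only variables; proxy atoms alone keep their symbols. -/
theorem syms_kernel {A : Set P} {C : Clause S}
    (h : ∀ l ∈ C, ∀ Q, l.atom = .proxy Q → colour l.atom ∉ A) :
    (kernel colour A C).syms = ∅ := by
  refine eq_empty_of_forall_notMem fun g hg => ?_
  rw [kernel, Formula.syms_conj] at hg
  obtain ⟨φ, hφ, hg⟩ := mem_iUnion₂.1 hg
  obtain ⟨l, hl, rfl⟩ := List.mem_map.1 hφ
  rw [List.mem_filter] at hl
  rw [flattenLit, Formula.syms_signed] at hg
  cases e : l.atom with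
  | proxy Q => exact h l hl.1 Q e (of_decide_eq_true hl.2)
  | base a =>
    rw [show l.neg.atom = .base a from e, PAtom.syms_flatten_base] at hg
    exact hg

theorem free_kernel {A : Set P} {C : Clause S} {y : Σ s, Var S s}
    (hy : y ∈ (kernel colour A C).free) :
    ∃ (s : Srt S.USort) (t : GTerm S s), y = ⟨s, .flat t⟩ ∧ Supported C t := by
  rw [kernel, Formula.free_conj] at hy
  obtain ⟨φ, hφ, hg⟩ := mem_iUnion₂.1 hy
  obtain ⟨l, hl, rfl⟩ := List.mem_map.1 hφ
  rw [List.mem_filter] at hl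
  rw [flattenLit, Formula.free_signed] at hg
  obtain ⟨b, hb, t, ht, rfl⟩ := PAtom.free_flatten hg
  exact ⟨_, _, rfl, l, hl.1, b, hb, t, ht, .refl⟩

end Kernel

/-! ## Trees -/

section Tree

variable (T : InterpTree V)

theorem InterpTree.st_leaf (p : T.Leaf) : T.st p.1 = {p} := by
  ext q
  constructor
  · intro h
    rcases ReflTransGen.cases_tail h with h | ⟨c, -, hc⟩
    · exact Subtype.ext h.symm
    · exact (p.2 c hc).elim
  · rintro rfl
    exact ReflTransGen.refl

/-- Following the outgoing edges must stop, by finiteness and acyclicity, and it can only stop at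
the root. -/
theorem InterpTree.st_root [Finite V] : T.st T.root = univ := by
  have hwf : WellFounded (fun a b => TransGen T.E b a) := by
    have : Std.Irrefl (fun a b => TransGen T.E b a) := ⟨fun a => T.acyclic a⟩
    have : IsTrans V (fun a b => TransGen T.E b a) := ⟨fun _ _ _ h h' => h'.trans h⟩
    exact Finite.wellFounded_of_trans_of_irrefl _
  have key : ∀ v, ReflTransGen T.E v T.root := by
    intro v
    induction v using hwf.induction with
    | _ v ih =>
      by_cases hv : v = T.root
      · rw [hv]
      · obtain ⟨w, hw, -⟩ := T.out_unique v hv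
        exact .head hw (ih w (.single hw))
  exact eq_univ_of_forall fun p => key p.1

theorem InterpTree.eq_of_E {u v w : V} (h : T.E u v) (h' : T.E u w) : v = w := by
  have hu : u ≠ T.root := by
    rintro rfl
    exact T.root_out _ h
  exact (T.out_unique u hu).unique h h'

theorem InterpTree.st_inner {v a b : V} (hab : a ≠ b) (ha : T.E a v) (hb : T.E b v) :
    T.st v = T.st a ∪ T.st b := by
  have hE : ∀ u, T.E u v → u = a ∨ u = b := by
    rcases T.binary v with h | ⟨c, d, -, h⟩
    · exact (h a ha).elim
    · intro u hu
      have h1 := (h a).1 ha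
      have h2 := (h b).1 hb
      have h3 := (h u).1 hu
      grind
  ext q
  constructor
  · intro h
    rcases ReflTransGen.cases_tail h with h | ⟨c, hqc, hc⟩
    · exact (q.2 a (h ▸ ha)).elim
    · rcases hE c hc with rfl | rfl
      · exact .inl hqc
      · exact .inr hqc
  · rintro (h | h)
    · exact ReflTransGen.tail h ha
    · exact ReflTransGen.tail h hb

/-- Out-edges are unique, so two nodes above a common leaf are comparable. A path between the
distinct siblings `a` and `b` would leave through `v` and close a cycle. -/
theorem InterpTree.st_disjoint {v a b : V} (hab : a ≠ b) (ha : T.E a v) (hb : T.E b v) :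
    Disjoint (T.st a) (T.st b) := by
  have key : ∀ {a b : V}, a ≠ b → T.E a v → T.E b v → ¬ ReflTransGen T.E a b := by
    intro a b hab ha hb h
    rcases ReflTransGen.cases_head h with h | ⟨c, hac, hcb⟩
    · exact hab h
    · obtain rfl := T.eq_of_E ha hac
      exact T.acyclic _ (TransGen.tail' hcb hb)
  refine disjoint_left.2 fun q hqa hqb => ?_
  have hU : Relator.RightUnique T.E := fun _ _ _ h h' => T.eq_of_E h h'
  rcases ReflTransGen.total_of_right_unique hU hqa hqb with h | h
  · exact key hab ha hb h
  · exact key hab.symm hb ha h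

end Tree

/-! ## Removal of variables -/

theorem Model.nonempty_dom (M : Model S) (s : Srt S.USort) : Nonempty (M.Dom s) := by
  cases s with
  | rat => exact ⟨(0 : ℚ)⟩
  | bool => exact ⟨true⟩
  | un u => exact M.nonempty u

theorem vars_app_flatVar (f : Sym S) (args : ∀ i : Fin f.dom.length, GTerm S (f.dom.get i)) :
    (Term.app f (fun i => flatVar (args i)) : Term S (Var S) f.cod).vars =
      ⋃ i, {⟨_, .flat (args i)⟩} := rfl

theorem syms_app_flatVar (f : Sym S) (args : ∀ i : Fin f.dom.length, GTerm S (f.dom.get i)) :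
    (Term.app f (fun i => flatVar (args i)) : Term S (Var S) f.cod).syms = f.syms := by
  simp [Term.syms, flatVar]

/-- The truth value of a formula after the removal of `v_t` for `t = f(t₁,…,tₙ)`. -/
def EvalRemoved {P : Type} (parts A : Set P) (M : Model S) (ρ : Assign M (Var S)) (f : Sym S)
    (args : ∀ i : Fin f.dom.length, GTerm S (f.dom.get i)) (φ : Formula S) : Prop :=
  if parts ⊆ A then
    ∃ d : M.Dom f.cod, φ.eval M (Function.update ρ ⟨f.cod, .flat (.app f args)⟩ d)
  else if parts ∩ A = ∅ then
    ∀ d : M.Dom f.cod, φ.eval M (Function.update ρ ⟨f.cod, .flat (.app f args)⟩ d)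
  else
    φ.eval M (Function.update ρ ⟨f.cod, .flat (.app f args)⟩
      (M.interp f fun i => ρ ⟨_, .flat (args i)⟩))

/-- The bound variable is fresh, so its value can be handed to `v_t` without capture or interference
with another free variable. -/
theorem eval_removeVar {P : Type} (parts A : Set P) (M : Model S) (ρ : Assign M (Var S))
    (f : Sym S) (args : ∀ i : Fin f.dom.length, GTerm S (f.dom.get i)) (φ : Formula S) :
    (removeVar parts A f args φ).eval M ρ ↔ EvalRemoved parts A M ρ f args φ := by
  have hocc := φ.fresh_notMem_occ f.cod
  have key : ∀ d : M.Dom f.cod,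
      (φ.replace (.app f args) (.var (.bnd (φ.fresh f.cod)))).eval M
        (Function.update ρ (⟨f.cod, .bnd (φ.fresh f.cod)⟩ : Σ s, Var S s) d) ↔
      φ.eval M (Function.update ρ ⟨f.cod, .flat (.app f args)⟩ d) := by
    intro d
    rw [Formula.eval_replace]
    · refine Formula.eval_congr M φ fun x hx => ?_
      by_cases h : x = ⟨_, .flat (.app f args)⟩
      · subst h
        simp [Term.eval]
      · rw [Function.update_of_ne h, Function.update_of_ne h, Function.update_of_ne]
        rintro rfl
        exact hocc (φ.free_subset_occ hx)
    · rintro x rfl hb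
      exact hocc hb.mem_occ
  unfold removeVar EvalRemoved
  split_ifs with h1 h2
  · exact exists_congr key
  · exact forall_congr' key
  · rw [Formula.eval_replace]
    · rfl
    · intro x hx hb
      rw [vars_app_flatVar] at hx
      obtain ⟨i, rfl⟩ := mem_iUnion.1 hx
      exact hb.ne_flat

/-- This makes `EvalRemoved` describe every label after a step, including those left untouched
because `v_t` is absent. The quantifiers are vacuous since domains are nonempty. -/
theorem evalRemoved_of_notMem_free {P : Type} (parts A : Set P) (M : Model S)
    (ρ : Assign M (Var S)) (f : Sym S)
    (args : ∀ i : Fin f.dom.length, GTerm S (f.dom.get i)) (φ : Formula S)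
    (h : (⟨_, .flat (.app f args)⟩ : Σ s, Var S s) ∉ φ.free) :
    EvalRemoved parts A M ρ f args φ ↔ φ.eval M ρ := by
  have key : ∀ d : M.Dom f.cod,
      φ.eval M (Function.update ρ ⟨f.cod, .flat (.app f args)⟩ d) ↔ φ.eval M ρ := fun d =>
    Formula.eval_congr M φ fun x hx => Function.update_of_ne (fun e => h (by rwa [← e])) ..
  have := M.nonempty_dom f.cod
  unfold EvalRemoved
  simp only [key, exists_const, forall_const, ite_self]

theorem free_removeVar_subset {P : Type} (parts A : Set P) (f : Sym S)
    (args : ∀ i : Fin f.dom.length, GTerm S (f.dom.get i)) (φ : Formula S) :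
    (removeVar parts A f args φ).free ⊆
      (φ.free \ {⟨_, .flat (.app f args)⟩}) ∪ ⋃ i, {⟨_, .flat (args i)⟩} := by
  unfold removeVar
  split_ifs
  · rintro x ⟨hx, hn⟩
    exact (φ.free_replace_subset _ _ hx).imp id fun h => (hn h).elim
  · rintro x ⟨hx, hn⟩
    exact (φ.free_replace_subset _ _ hx).imp id fun h => (hn h).elim
  · exact φ.free_replace_subset _ _

/-- Only the substitution branch writes `f` into the label, and its two conditions say that `f` has
a partition inside `A` and one outside. -/
theorem syms_removeVar_subset {P : Type} (parts A : Set P) (f : Sym S)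
    (args : ∀ i : Fin f.dom.length, GTerm S (f.dom.get i)) (φ : Formula S) {g : S.Fn}
    (hg : g ∈ (removeVar parts A f args φ).syms) :
    g ∈ φ.syms ∨ (g ∈ f.syms ∧ ¬ parts ⊆ A ∧ parts ∩ A ≠ ∅) := by
  unfold removeVar at hg
  split_ifs at hg with h1 h2
  · exact (φ.syms_replace_subset _ _ hg).imp id fun h => h.elim
  · exact (φ.syms_replace_subset _ _ hg).imp id fun h => h.elim
  · refine (φ.syms_replace_subset _ _ hg).imp id fun h => ?_
    rw [syms_app_flatVar] at h
    exact ⟨h, h1, h2⟩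

/-- The assignment satisfies the flattening equalities `v_{f(t₁,…,tₙ)} = f(v_{t₁},…,v_{tₙ})`
for the symbols `f` of the partition `p`. -/
def FlatEq {P : Type} (F : P → Formula S) (M : Model S) (p : P) (ρ : Assign M (Var S)) : Prop :=
  ∀ (f : Sym S) (args : ∀ i : Fin f.dom.length, GTerm S (f.dom.get i)), p ∈ partitions F f →
    ρ ⟨_, .flat (.app f args)⟩ = M.interp f (fun i => ρ ⟨_, .flat (args i)⟩)

/-- The values `ρ` of the ground terms, recomputed for the terms that properly contain `t`. -/
def recomputed (M : Model S) (ρ : Assign M (Var S)) {s : Srt S.USort} (t : GTerm S s) :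
    {s' : Srt S.USort} → GTerm S s' → M.Dom s'
  | _, .var x => x.elim
  | _, .app g b =>
      if ProperSubterm t (.app g b) then M.interp g (fun i => recomputed M ρ t (b i))
      else ρ ⟨_, .flat (.app g b)⟩

theorem recomputed_of_not (M : Model S) (ρ : Assign M (Var S)) {s : Srt S.USort} {t : GTerm S s}
    {s' : Srt S.USort} {u : GTerm S s'} (h : ¬ ProperSubterm t u) :
    recomputed M ρ t u = ρ ⟨_, .flat u⟩ := by
  cases u with
  | var x => exact x.elim
  | app g b => rw [recomputed, if_neg h]

/-- The assignment with recomputed values of the flattening variables. -/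
def recomputeAssign (M : Model S) (ρ : Assign M (Var S)) {s : Srt S.USort} (t : GTerm S s) :
    Assign M (Var S)
  | ⟨_, .flat u⟩ => recomputed M ρ t u
  | ⟨s, .bnd n⟩ => ρ ⟨s, .bnd n⟩

theorem flat_sigma_inj {s s' : Srt S.USort} {t : GTerm S s} {t' : GTerm S s'}
    (h : (⟨s, .flat t⟩ : Σ s, Var S s) = ⟨s', .flat t'⟩) :
    (⟨s, t⟩ : Σ s, GTerm S s) = ⟨s', t'⟩ := by
  cases h
  rfl

/-- Giving `v_t` the arbitrary value `d` breaks only equalities in which `v_t` is on the left or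
among the arguments on the right. The first kind is not demanded, as `p` does not own `f`; the
second is repaired, together with all larger terms, by recomputation. -/
theorem flatEq_recomputeAssign {P : Type} {F : P → Formula S} {M : Model S} {p : P}
    {ρ : Assign M (Var S)} (h : FlatEq F M p ρ) {f : Sym S}
    {args : ∀ i : Fin f.dom.length, GTerm S (f.dom.get i)} (hp : p ∉ partitions F f)
    (d : M.Dom f.cod) :
    FlatEq F M p (recomputeAssign M (Function.update ρ ⟨f.cod, .flat (.app f args)⟩ d)
      (.app f args)) := by
  intro g b hg
  simp only [recomputeAssign]
  by_cases hs : ProperSubterm (.app f args) (.app g b)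
  · rw [recomputed, if_pos hs]
  -- Here neither `g(b)` nor any argument properly contains `t`, no argument is `t`, and `g(b)` is
  -- not `t`; the old equality survives.
  · rw [recomputed_of_not _ _ hs, Function.update_of_ne, h g b hg]
    · congr 1
      funext i
      rw [recomputed_of_not _ _ fun h => hs (h.arg i), Function.update_of_ne]
      intro e
      refine hs ⟨g, b, i, .refl, ?_⟩
      exact flat_sigma_inj e
    · intro e
      obtain rfl : g = f := congrArg Sigma.fst (Term.app_inj (flat_sigma_inj e))
      exact hp hg

/-! ## Termination of variable removal -/

/-- The ground terms whose flattening variables are free in some label. -/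
def freeTerms (J : V → Formula S) : Set (Σ s, GTerm S s) :=
  {x | ∃ v, (⟨x.1, .flat x.2⟩ : Σ s, Var S s) ∈ (J v).free}

theorem freeTerms_finite [Finite V] (J : V → Formula S) : (freeTerms J).Finite := by
  have hinj : Function.Injective (fun x : Σ s, GTerm S s => (⟨x.1, .flat x.2⟩ : Σ s, Var S s)) :=
    fun x y h => flat_sigma_inj h
  have : freeTerms J = ⋃ v, (fun x : Σ s, GTerm S s => (⟨x.1, .flat x.2⟩ : Σ s, Var S s)) ⁻¹'
      (J v).free := by
    ext x
    simp [freeTerms]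
  rw [this]
  exact finite_iUnion fun v =>
    ((J v).occ_finite.subset (J v).free_subset_occ).preimage hinj.injOn

/-- The total size of the ground terms whose flattening variables are free in some label. -/
def freeWeight [Finite V] (J : V → Formula S) : ℕ :=
  ∑ x ∈ (freeTerms_finite J).toFinset, x.2.size

section Removal

variable {T : InterpTree V} {F : T.Leaf → Formula S} {C : Clause S} {J J' : V → Formula S}

theorem freeTerms_removed {f : Sym S} {args : ∀ i : Fin f.dom.length, GTerm S (f.dom.get i)}
    (h : ∀ v, J' v = if (⟨_, .flat (.app f args)⟩ : Σ s, Var S s) ∈ (J v).free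
      then removeVar (partitions F f) (T.st v) f args (J v) else J v) (v : V)
    {x : Σ s, Var S s} (hx : x ∈ (J' v).free) :
    (x ∈ (J v).free ∧ x ≠ ⟨_, .flat (.app f args)⟩) ∨
      ((⟨_, .flat (.app f args)⟩ : Σ s, Var S s) ∈ (J v).free ∧
        ∃ i, x = ⟨_, .flat (args i)⟩) := by
  rw [h v] at hx
  split_ifs at hx with hv
  · rcases free_removeVar_subset _ _ _ _ _ hx with hx | hx
    · exact .inl hx
    · obtain ⟨i, hx⟩ := mem_iUnion.1 hx
      exact .inr ⟨hv, i, hx⟩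
  · exact .inl ⟨hx, fun e => hv (e ▸ hx)⟩

/-- A step deletes `t`, of size one plus the sizes of its arguments, and adds at most the arguments.
Arguments that coincide or were already present only make the new sum smaller. -/
theorem freeWeight_lt [Finite V] (h : RemoveStep T F C J J') : freeWeight J' < freeWeight J := by
  obtain ⟨f, args, -, ⟨v, hv⟩, -, hJ⟩ := h
  set t : Σ s, GTerm S s := ⟨_, .app f args⟩ with ht
  have hmem : t ∈ (freeTerms_finite J).toFinset := (freeTerms_finite J).mem_toFinset.2 ⟨v, hv⟩
  have hsub : (freeTerms_finite J').toFinset ⊆ (freeTerms_finite J).toFinset.erase t ∪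
      Finset.univ.image fun i => (⟨_, args i⟩ : Σ s, GTerm S s) := by
    intro x hx
    obtain ⟨w, hw⟩ := (freeTerms_finite J').mem_toFinset.1 hx
    rw [Finset.mem_union, Finset.mem_erase, Finset.mem_image]
    rcases freeTerms_removed hJ w hw with ⟨h1, h2⟩ | ⟨-, i, hi⟩
    · refine .inl ⟨?_, (freeTerms_finite J).mem_toFinset.2 ⟨w, h1⟩⟩
      rintro rfl
      exact h2 rfl
    · exact .inr ⟨i, Finset.mem_univ i, (flat_sigma_inj hi).symm⟩
  have h1 := Finset.sum_le_sum_of_subset (f := fun x : Σ s, GTerm S s => x.2.size) hsub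
  have h2 := Finset.sum_union_inter (f := fun x : Σ s, GTerm S s => x.2.size)
    (s₁ := (freeTerms_finite J).toFinset.erase t)
    (s₂ := Finset.univ.image fun i => (⟨_, args i⟩ : Σ s, GTerm S s))
  have h3 : ∑ x ∈ Finset.univ.image fun i => (⟨_, args i⟩ : Σ s, GTerm S s), x.2.size ≤
      ∑ i, (args i).size :=
    Finset.sum_image_le_of_nonneg (fun _ _ => Nat.zero_le _)
  have h4 := Finset.add_sum_erase _ (fun x : Σ s, GTerm S s => x.2.size) hmem
  have h5 : t.2.size = 1 + ∑ i, (args i).size := rfl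
  unfold freeWeight
  omega

theorem wellFounded_removeStep [Finite V] (T : InterpTree V) (F : T.Leaf → Formula S)
    (C : Clause S) : WellFounded fun J' J : V → Formula S => RemoveStep T F C J J' :=
  Subrelation.wf (fun h => freeWeight_lt h) (measure freeWeight).wf

/-- An unsupported free term of maximal size is outermost even among the supported ones: any term
properly containing it would be larger, and unsupported because support passes to subterms. -/
theorem exists_removeStep [Finite V] {v : V} {s : Srt S.USort} {t : GTerm S s}
    (ht : (⟨s, .flat t⟩ : Σ s, Var S s) ∈ (J v).free) (hs : ¬ Supported C t) :
    ∃ J', RemoveStep T F C J J' := by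
  obtain ⟨⟨s, t⟩, ⟨ht, hs⟩, hmax⟩ := Set.exists_max_image
    (freeTerms J ∩ {x | ¬ Supported C x.2}) (fun x => x.2.size)
    ((freeTerms_finite J).inter_of_left _) ⟨⟨s, t⟩, ⟨v, ht⟩, hs⟩
  cases t with
  | var x => exact x.elim
  | app f args =>
    refine ⟨_, f, args, hs, ht, ?_, fun v => rfl⟩
    intro w s' t' ht' hp
    have := hmax ⟨s', t'⟩ ⟨⟨w, ht'⟩, fun h => hs (h.subterm hp.subterm)⟩
    have := hp.size_lt
    simp only at *
    omega

theorem exists_removeAll [Finite V] (T : InterpTree V) (F : T.Leaf → Formula S) (C : Clause S)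
    (J : V → Formula S) : ∃ J', RemoveAll T F C J J' := by
  induction J using (wellFounded_removeStep T F C).induction with
  | _ J ih =>
    by_cases h : ∀ (v : V) (s : Srt S.USort) (t : GTerm S s),
        (⟨s, .flat t⟩ : Σ s, Var S s) ∈ (J v).free → Supported C t
    · exact ⟨J, .refl, h⟩
    · push Not at h
      obtain ⟨v, s, t, ht, hs⟩ := h
      obtain ⟨J₁, h₁⟩ := exists_removeStep (T := T) (F := F) ht hs
      obtain ⟨J', h', hJ'⟩ := ih J₁ h₁
      exact ⟨J', .head h₁ h', hJ'⟩

end Removal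

/-! ## Partial tree interpolants -/

/-- The labels `J` interpolate the input together with the negation of the clause `C`, up to
flattening. -/
structure IsPartialInterpolant (T : InterpTree V) (K : T.Leaf → CNF S)
    (colour : PAtom S → T.Leaf) (C : Clause S) (J : V → Formula S) : Prop where
  root : ∀ (M : Model S) (ρ : Assign M (Var S)), ¬ (J T.root).eval M ρ
  leaf : ∀ (p : T.Leaf) (M : Model S) (ρ : Assign M (Var S)),
    (cnfFormula (K p)).eval M ρ → FlatEq (fun p => cnfFormula (K p)) M p ρ →
    (∀ l ∈ C, colour l.atom = p → ¬ l.Holds M (flatValue M ρ)) → (J p.1).eval M ρ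
  inner : ∀ v a b : V, a ≠ b → T.E a v → T.E b v → ∀ (M : Model S) (ρ : Assign M (Var S)),
    (J a).eval M ρ → (J b).eval M ρ → (J v).eval M ρ
  symbols : ∀ v : V, (J v).syms ⊆ (⋃ p ∈ T.st v, (cnfFormula (K p)).syms) ∩
    (⋃ p ∈ (T.st v)ᶜ, (cnfFormula (K p)).syms)

/-- The free variables of the formula are flattening variables of terms with the property. -/
def FlatFree (N : ∀ s : Srt S.USort, GTerm S s → Prop) (φ : Formula S) : Prop :=
  ∀ x ∈ φ.free, ∃ (s : Srt S.USort) (t : GTerm S s), x = ⟨s, .flat t⟩ ∧ N s t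

theorem eval_cnfFormula_congr (M : Model S) (ρ ρ' : Assign M (Var S)) (K : CNF S) :
    (cnfFormula K).eval M ρ ↔ (cnfFormula K).eval M ρ' := by
  rw [eval_cnfFormula, eval_cnfFormula]

theorem Lit.holds_congr (M : Model S) {e e' : ∀ s : Srt S.USort, GTerm S s → M.Dom s}
    (l : Lit (PAtom S)) (h : ∀ a, l.atom = .base a → ∀ t ∈ a.terms, e t.1 t.2 = e' t.1 t.2) :
    l.Holds M e ↔ l.Holds M e' := by
  obtain ⟨b, a⟩ := l
  cases a with
  | proxy Q => rfl
  | base a =>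
    simp only [Lit.Holds, PAtom.Holds]
    rw [Atom.holds_congr M a (h a rfl)]

/-! ### Variable removal preserves partial interpolants -/

section Removal

variable {T : InterpTree V} {K : T.Leaf → CNF S} {colour : PAtom S → T.Leaf} {C : Clause S}
  {J J' : V → Formula S}

/-- The leaf `p` serves the theory symbols, whose partitions are all leaves. Nonemptiness matters
because an empty set of partitions would put an existential quantifier into every label. -/
theorem partitions_nonempty {f : Sym S} (h : ∀ g ∈ f.syms, ∃ p, g ∈ (cnfFormula (K p)).syms)
    (p : T.Leaf) : (partitions (fun p => cnfFormula (K p)) f).Nonempty := by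
  cases f with
  | fn g => exact h g rfl
  | num | add | smul | truth => exact ⟨p, trivial⟩

theorem mem_syms_of_mem_partitions {P : Type} {F : P → Formula S} {f : Sym S} {p : P}
    (hp : p ∈ partitions F f) {g : S.Fn} (hg : g ∈ f.syms) : g ∈ (F p).syms := by
  cases f with
  | fn g' =>
    obtain rfl : g = g' := hg
    exact hp
  | num | add | smul | truth => exact hg.elim

theorem FlatFree.removeStep {F : T.Leaf → Formula S}
    {N : ∀ s : Srt S.USort, GTerm S s → Prop}
    (hN : ∀ {s s' : Srt S.USort} {t : GTerm S s} {u : GTerm S s'}, N s' u → Subterm t u → N s t)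
    (h : ∀ v, FlatFree N (J v)) (hstep : RemoveStep T F C J J') (v : V) : FlatFree N (J' v) := by
  obtain ⟨f, args, -, -, -, hJ⟩ := hstep
  intro x hx
  rcases freeTerms_removed hJ v hx with ⟨hx, -⟩ | ⟨ht, i, rfl⟩
  · exact h v x hx
  · obtain ⟨s, t, e, ht⟩ := h v _ ht
    cases flat_sigma_inj e
    exact ⟨_, _, rfl, hN ht (.arg f args i .refl)⟩

/-- `X`, `Y`, `Z` are the labels of two children and their parent as predicates of the value of
`v_t`, and `c` stands for `f(v_{t₁},…,v_{tₙ})`. If one child owns all partitions of `f`, the other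
owns none and is universal, so it holds at the witness of the first. -/
theorem removed_inner {P D : Type} {parts A B : Set P} (hne : parts.Nonempty)
    (hdis : Disjoint A B) {X Y Z : D → Prop} (h : ∀ d, X d → Y d → Z d) {c : D}
    (hX : if parts ⊆ A then ∃ d, X d else if parts ∩ A = ∅ then ∀ d, X d else X c)
    (hY : if parts ⊆ B then ∃ d, Y d else if parts ∩ B = ∅ then ∀ d, Y d else Y c) :
    if parts ⊆ A ∪ B then ∃ d, Z d else if parts ∩ (A ∪ B) = ∅ then ∀ d, Z d else Z c := by
  have key : ∀ {A B : Set P} {Y : D → Prop}, Disjoint A B → parts ⊆ A →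
      (if parts ⊆ B then ∃ d, Y d else if parts ∩ B = ∅ then ∀ d, Y d else Y c) →
      ∀ d, Y d := by
    intro A B Y hd hA hY
    have hB : parts ∩ B = ∅ := disjoint_iff_inter_eq_empty.1 (hd.mono_left hA)
    rw [if_neg, if_pos hB] at hY
    · exact hY
    · intro hB'
      rw [inter_eq_left.2 hB'] at hB
      exact hne.ne_empty hB
  by_cases hA : parts ⊆ A
  · rw [if_pos (hA.trans subset_union_left)]
    rw [if_pos hA] at hX
    exact hX.imp fun d hd => h d hd (key hdis hA hY d)
  by_cases hB : parts ⊆ B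
  · rw [if_pos (hB.trans subset_union_right)]
    rw [if_pos hB] at hY
    exact hY.imp fun d hd => h d (key hdis.symm hB hX d) hd
  rw [if_neg hA] at hX
  rw [if_neg hB] at hY
  have hU : parts ∩ (A ∪ B) = ∅ ↔ parts ∩ A = ∅ ∧ parts ∩ B = ∅ := by
    rw [inter_union_distrib_left, union_empty_iff]
  by_cases hab : parts ∩ A = ∅ ∧ parts ∩ B = ∅
  · rw [if_neg, if_pos (hU.2 hab)]
    · rw [if_pos hab.1] at hX
      rw [if_pos hab.2] at hY
      exact fun d => h d (hX d) (hY d)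
    · intro hs
      have := hU.2 hab
      rw [inter_eq_left.2 hs] at this
      exact hne.ne_empty this
  -- Neither side is existential, so both hold at `c`; the parent is then true at `c`, which also
  -- serves as witness if the parent is existential.
  · have hXc : X c := by
      split_ifs at hX
      exacts [hX c, hX]
    have hYc : Y c := by
      split_ifs at hY
      exacts [hY c, hY]
    split_ifs with h1 h2
    exacts [⟨c, h c hXc hYc⟩, (hab (hU.1 h2)).elim, h c hXc hYc]

/-- The root label acquires an existential quantifier, harmless since it is false for all values.
Inner nodes are `removed_inner`. At a leaf, the set `{p}` either meets the partitions of `f`, so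
that a flattening equality is available, or misses them, so that `v_t` is arbitrary for `p`. -/
theorem IsPartialInterpolant.removeStep [Finite V]
    (h : IsPartialInterpolant T K colour C J)
    (hfree : ∀ v, FlatFree
      (fun _ t => ∀ g ∈ t.syms, ∃ p, g ∈ (cnfFormula (K p)).syms) (J v))
    (hstep : RemoveStep T (fun p => cnfFormula (K p)) C J J') :
    IsPartialInterpolant T K colour C J' := by
  obtain ⟨f, args, hsupp, ⟨v₀, hv₀⟩, hout, hJ⟩ := hstep
  have hev : ∀ v M ρ, (J' v).eval M ρ ↔
      EvalRemoved (partitions (fun p => cnfFormula (K p)) f) (T.st v) M ρ f args (J v) := by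
    intro v M ρ
    rw [hJ v]
    split_ifs with hv
    · exact eval_removeVar ..
    · exact (evalRemoved_of_notMem_free _ _ _ _ _ _ _ hv).symm
  have hne : ∀ p : T.Leaf, (partitions (fun p => cnfFormula (K p)) f).Nonempty := by
    obtain ⟨s, t, e, ht⟩ := hfree v₀ _ hv₀
    cases flat_sigma_inj e
    exact fun p => partitions_nonempty (fun g hg => ht g (.inl hg)) p
  set parts := partitions (fun p => cnfFormula (K p)) f with hparts
  refine ⟨?_, ?_, ?_, ?_⟩
  · intro M ρ hroot
    rw [hev, EvalRemoved, T.st_root, if_pos (subset_univ _)] at hroot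
    obtain ⟨d, hd⟩ := hroot
    exact h.root M _ hd
  · intro p M ρ hF hflat hC
    -- If `p` owns `f`, its flattening equality says that `ρ` already gives `v_t` the value
    -- `f(v_{t₁},…,v_{tₙ})`, so the update changes nothing.
    have hself : FlatEq (fun p => cnfFormula (K p)) M p ρ → p ∈ parts →
        (J p.1).eval M (Function.update ρ ⟨f.cod, .flat (.app f args)⟩
          (M.interp f fun i => ρ ⟨_, .flat (args i)⟩)) := by
      intro _ hp
      rw [← hflat f args hp, Function.update_eq_self]
      exact h.leaf p M ρ hF hflat hC
    rw [hev, EvalRemoved, T.st_leaf]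
    split_ifs with h1 h2
    · obtain ⟨q, hq⟩ := hne p
      obtain rfl : q = p := h1 hq
      exact ⟨_, hself hflat hq⟩
    · have hp : p ∉ parts := fun hp => eq_empty_iff_forall_notMem.1 h2 p ⟨hp, rfl⟩
      intro d
      -- The label of `p` is to hold for every value `d` of `v_t`, so the old leaf condition is
      -- applied to an assignment with this value that still satisfies the flattening equalities of
      -- `p`.
      set ρ' := recomputeAssign M (Function.update ρ ⟨f.cod, .flat (.app f args)⟩ d)
        (.app f args) with hρ'
      have hJ' := h.leaf p M ρ' ((eval_cnfFormula_congr M _ _ _).1 hF)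
        (flatEq_recomputeAssign hflat hp d) (by
          intro l hl hlp
          rw [Lit.holds_congr M (e' := flatValue M ρ)]
          · exact hC l hl hlp
          -- The literals of `C` keep their truth values: a top-level term equal to `t` or properly
          -- containing it would make `t` supported.
          · intro a ha t ht
            simp only [flatValue, hρ', recomputeAssign]
            rw [recomputed_of_not, Function.update_of_ne]
            · intro e
              obtain ⟨s, t⟩ := t
              cases flat_sigma_inj e
              exact hsupp ⟨l, hl, a, ha, _, ht, .refl⟩
            · exact fun hs => hsupp ⟨l, hl, a, ha, _, ht, hs.subterm⟩)
      -- The recomputed variables are not free in the label, because `t` is not a proper subterm of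
      -- any free one.
      refine (Formula.eval_congr M _ fun x hx => ?_).1 hJ'
      obtain ⟨s, t, rfl, -⟩ := hfree _ x hx
      exact recomputed_of_not _ _ (hout _ _ _ hx)
    · refine hself hflat ?_
      by_contra hp
      refine h2 (eq_empty_of_forall_notMem ?_)
      rintro q ⟨hq, rfl⟩
      exact hp hq
  · intro v a b hab ha hb M ρ hJa hJb
    rw [hev] at hJa hJb ⊢
    rw [EvalRemoved, T.st_inner hab ha hb]
    -- The colour of an arbitrary atom supplies the leaf that `hne` asks for.
    exact removed_inner (hne (colour (.proxy []))) (T.st_disjoint hab ha hb)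
      (fun d => h.inner v a b hab ha hb M _) hJa hJb
  · intro v g hg
    rw [hJ v] at hg
    split_ifs at hg
    · rcases syms_removeVar_subset _ _ _ _ _ hg with hg | ⟨hg, h1, h2⟩
      · exact h.symbols v hg
      · obtain ⟨p, hp, hp'⟩ := not_subset.1 h1
        obtain ⟨q, hq, hq'⟩ := nonempty_iff_ne_empty.2 h2
        exact ⟨mem_biUnion hq' (mem_syms_of_mem_partitions hq hg),
          mem_biUnion (x := p) hp' (mem_syms_of_mem_partitions hp hg)⟩
    · exact h.symbols v hg

end Removal

/-! ## Labels of the leaves of the proof -/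

section Rules

variable {T : InterpTree V} {K : T.Leaf → CNF S} {colour : PAtom S → T.Leaf} {C : Clause S}
  {J : V → Formula S}

theorem Lit.holds_false {M : Model S} {e : ∀ s : Srt S.USort, GTerm S s → M.Dom s}
    {a : PAtom S} : (⟨false, a⟩ : Lit (PAtom S)).Holds M e ↔ ¬ a.Holds M e := by
  simp [Lit.Holds]

theorem Lit.holds_true {M : Model S} {e : ∀ s : Srt S.USort, GTerm S s → M.Dom s}
    {a : PAtom S} : (⟨true, a⟩ : Lit (PAtom S)).Holds M e ↔ a.Holds M e := by
  simp [Lit.Holds]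

/-- Where `q` lies below `v`, the label says that some literal coloured outside is true; elsewhere
it says that all literals coloured inside are false. Only the leaf `q` has to know that `C` holds.
At an inner node above `q`, the true literal found outside one child cannot lie in the other, whose
literals are all false. -/
theorem isPartialInterpolant_attributed [Finite V] (q : T.Leaf)
    (hproxy : ∀ l ∈ C, ∀ Q, l.atom = .proxy Q → colour l.atom = q)
    (hC : ∀ (M : Model S) (ρ : Assign M (Var S)), (cnfFormula (K q)).eval M ρ →
      FlatEq (fun p => cnfFormula (K p)) M q ρ → ∃ l ∈ C, l.Holds M (flatValue M ρ))
    (hJ : ∀ v, J v = attributed colour q (T.st v) C) :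
    IsPartialInterpolant T K colour C J := by
  have hev : ∀ v M ρ, (J v).eval M ρ ↔ if q ∈ T.st v then
      ∃ l ∈ C, colour l.atom ∉ T.st v ∧ l.Holds M (flatValue M ρ)
      else ∀ l ∈ C, colour l.atom ∈ T.st v → ¬ l.Holds M (flatValue M ρ) := by
    intro v M ρ
    rw [hJ v, attributed]
    split_ifs
    · simp only [Formula.eval, eval_kernel, mem_compl_iff]
      push Not
      rfl
    · exact eval_kernel ..
  refine ⟨?_, ?_, ?_, ?_⟩
  · intro M ρ h
    rw [hev, T.st_root, if_pos (mem_univ q)] at h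
    obtain ⟨l, -, hl, -⟩ := h
    exact hl (mem_univ _)
  · intro p M ρ hF hflat h
    rw [hev, T.st_leaf]
    split_ifs with hq
    · obtain rfl : q = p := hq
      obtain ⟨l, hl, hh⟩ := hC M ρ hF hflat
      exact ⟨l, hl, fun e => h l hl e hh, hh⟩
    · exact h
  · intro v a b hab ha hb M ρ h1 h2
    rw [hev] at h1 h2 ⊢
    have hdis := disjoint_left.1 (T.st_disjoint hab ha hb)
    rw [T.st_inner hab ha hb]
    by_cases hqa : q ∈ T.st a
    · rw [if_pos hqa] at h1
      rw [if_neg (hdis hqa)] at h2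
      rw [if_pos (.inl hqa)]
      obtain ⟨l, hl, hla, hh⟩ := h1
      exact ⟨l, hl, fun h => h.elim hla fun h => h2 l hl h hh, hh⟩
    rw [if_neg hqa] at h1
    by_cases hqb : q ∈ T.st b
    · rw [if_pos hqb] at h2
      rw [if_pos (.inr hqb)]
      obtain ⟨l, hl, hlb, hh⟩ := h2
      exact ⟨l, hl, fun h => h.elim (fun h => h1 l hl h hh) hlb, hh⟩
    · rw [if_neg hqb] at h2
      rw [if_neg fun h => h.elim hqa hqb]
      exact fun l hl h => h.elim (h1 l hl) (h2 l hl)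
  · intro v
    -- The kernel always collects literals from the side that does not contain `q`, while every
    -- proxy literal has colour `q`.
    have : (J v).syms = ∅ := by
      rw [hJ v, attributed]
      split_ifs with hq
      · refine syms_kernel colour fun l hl Q hlQ h => h ?_
        rwa [hproxy l hl Q hlQ]
      · refine syms_kernel colour fun l hl Q hlQ h => hq ?_
        rwa [← hproxy l hl Q hlQ]
    rw [this]
    exact empty_subset _

theorem flatFree_kernel {P : Type} (colour : PAtom S → P) (A : Set P) (C : Clause S) :
    FlatFree (fun _ t => Supported C t) (kernel colour A C) := fun _ hx => free_kernel colour hx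

theorem flatFree_attributed {P : Type} (colour : PAtom S → P) (p : P) (A : Set P)
    (C : Clause S) : FlatFree (fun _ t => Supported C t) (attributed colour p A C) := by
  unfold attributed
  split_ifs
  · exact flatFree_kernel colour Aᶜ C
  · exact flatFree_kernel colour A C

/-! ### Input clauses, instantiation, and congruence -/

/-- The flattening equalities of `p` unfold the part of the term built from symbols of `p` and stop
at the substituted terms `θ x`, whose symbols may be foreign. This is what instantiation needs; with
no variables it gives the case of input clauses. -/
theorem FlatEq.flatValue_eq {P : Type} {F : P → Formula S} {M : Model S} {p : P}
    {ρ : Assign M (Var S)} (h : FlatEq F M p ρ) {X : Srt S.USort → Type}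
    (θ : ∀ x : (Σ s, X s), GTerm S x.1) {s : Srt S.USort} (t : Term S X s)
    (ht : t.syms ⊆ (F p).syms) :
    flatValue M ρ s (t.subst θ) = t.eval M (fun x => flatValue M ρ x.1 (θ x)) := by
  induction t with
  | var x => rfl
  | app f args ih =>
    have hp : p ∈ partitions F f := by
      cases f with
      | fn g => exact ht (.inl rfl)
      | num | add | smul | truth => trivial
    refine (h f _ hp).trans ?_
    rw [Term.eval]
    congr 1
    funext i
    exact ih i fun g hg => ht (.inr (mem_iUnion.2 ⟨i, hg⟩))

theorem FlatEq.theory {P : Type} {F : P → Formula S} {M : Model S} {p : P}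
    {ρ : Assign M (Var S)} (h : FlatEq F M p ρ) (f : Sym S)
    (args : ∀ i : Fin f.dom.length, GTerm S (f.dom.get i)) (hf : f.syms = ∅) :
    flatValue M ρ f.cod (.app f args) = M.interp f (fun i => flatValue M ρ _ (args i)) := by
  refine h f args ?_
  cases f with
  | fn g => exact ((singleton_ne_empty g) hf).elim
  | num | add | smul | truth => trivial

theorem GTerm.subst_elim {s : Srt S.USort} (t : GTerm S s) :
    t.subst (fun x => x.2.elim) = t := by
  induction t with
  | var x => exact x.elim
  | app f args ih =>
    rw [Term.subst]
    congr 1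
    funext i
    exact ih i

theorem FlatEq.flatValue_eq_value {P : Type} {F : P → Formula S} {M : Model S} {p : P}
    {ρ : Assign M (Var S)} (h : FlatEq F M p ρ) {s : Srt S.USort} (t : GTerm S s)
    (ht : t.syms ⊆ (F p).syms) : flatValue M ρ s t = GTerm.value M s t := by
  have := h.flatValue_eq (fun x => x.2.elim) t ht
  rw [GTerm.subst_elim] at this
  rw [this]
  exact Term.eval_congr M t fun x _ => x.2.elim

/-- Arithmetic conversion relies on theory symbols only, and these belong to every partition, so
each partition's flattening equalities suffice. -/
theorem FlatEq.litConv {P : Type} {F : P → Formula S} {M : Model S} {p : P}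
    {ρ : Assign M (Var S)} (h : FlatEq F M p ρ) {l l' : Lit (PAtom S)} (hl : LitConv l l') :
    l.Holds M (flatValue M ρ) ↔ l'.Holds M (flatValue M ρ) := by
  cases hl with
  | same => rfl
  | conv b a a' ha => exact iff_congr (ha M (flatValue M ρ) h.theory) Iff.rfl

theorem FlatEq.clauseConv {P : Type} {F : P → Formula S} {M : Model S} {p : P}
    {ρ : Assign M (Var S)} (h : FlatEq F M p ρ) {C D : Clause S} (hCD : ClauseConv C D)
    (hC : ∃ l ∈ C, l.Holds M (flatValue M ρ)) : ∃ l ∈ D, l.Holds M (flatValue M ρ) := by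
  induction hCD with
  | nil => exact hC
  | cons hl _ ih =>
    rw [List.exists_mem_cons_iff] at hC ⊢
    exact hC.imp (h.litConv hl).1 ih

theorem clauseConv_proxy {C D : Clause S} (h : ClauseConv C D) {l : Lit (PAtom S)} (hl : l ∈ D)
    {Q : QClause S} (hQ : l.atom = .proxy Q) : l ∈ C := by
  induction h with
  | nil => exact hl
  | cons h' _ ih =>
    rcases List.mem_cons.1 hl with rfl | hl
    · cases h' with
      | same => exact List.mem_cons_self
      | conv => cases hQ
    · exact List.mem_cons_of_mem _ (ih hl)

theorem isPartialInterpolant_input [Finite V] {q : T.Leaf}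
    (hproxy : ∀ l ∈ C, ∀ Q, l.atom = .proxy Q → colour l.atom = q)
    {D : Clause S} (hD : D ∈ K q) (hDC : ClauseConv D C)
    (hJ : ∀ v, J v = attributed colour q (T.st v) C) :
    IsPartialInterpolant T K colour C J := by
  refine isPartialInterpolant_attributed q hproxy (fun M ρ hF hflat => ?_) hJ
  obtain ⟨l, hl, hh⟩ := (eval_cnfFormula M ρ (K q)).1 hF D hD
  refine hflat.clauseConv hDC ⟨l, hl, ?_⟩
  rw [Lit.holds_congr M (e' := GTerm.value M)]
  · exact hh
  · intro a ha t ht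
    refine hflat.flatValue_eq_value t.2 fun g hg => ?_
    exact clauseFormula_syms_subset_cnfFormula hD
      (base_syms_subset_clauseFormula hl ha (mem_biUnion ht hg))

/-- The proxy occurs in the input of its colour, which therefore owns all symbols of `Q`. The
quantified clause is then applied to the values of the flattening variables of the instantiating
terms. -/
theorem isPartialInterpolant_inst [Finite V] {Q : QClause S}
    {θ : ∀ x : (Σ s, QVar S s), GTerm S x.1} {D : Clause S}
    (hocc : ∃ C ∈ K (colour (.proxy Q)), ∃ l' ∈ C, l'.atom = .proxy Q)
    (hD : ClauseConv (QClause.inst Q θ) D)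
    (hJ : ∀ v, J v = attributed colour (colour (.proxy Q)) (T.st v) (⟨false, .proxy Q⟩ :: D)) :
    IsPartialInterpolant T K colour (⟨false, .proxy Q⟩ :: D) J := by
  refine isPartialInterpolant_attributed _ ?_ (fun M ρ hF hflat => ?_) hJ
  · intro l hl Q' hQ'
    rcases List.mem_cons.1 hl with rfl | hl
    · rfl
    · obtain ⟨l', -, rfl⟩ := List.mem_map.1 (clauseConv_proxy hD hl hQ')
      cases hQ'
  · rw [List.exists_mem_cons_iff, Lit.holds_false]
    by_cases hQ : (PAtom.proxy Q).Holds M (flatValue M ρ)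
    · refine .inr (hflat.clauseConv hD ?_)
      obtain ⟨l, hl, hh⟩ := hQ (fun x => flatValue M ρ x.1 (θ x))
      refine ⟨_, List.mem_map_of_mem hl, ?_⟩
      refine (iff_congr ?_ Iff.rfl).1 hh
      simp only [PAtom.Holds]
      rw [Atom.holds_subst]
      refine Atom.holds_congr M _ fun t ht => (hflat.flatValue_eq θ t.2 fun g hg => ?_).symm
      obtain ⟨C', hC', l', hl', hl'Q⟩ := hocc
      exact clauseFormula_syms_subset_cnfFormula hC'
        (proxy_syms_subset_clauseFormula hl' hl'Q hl (mem_biUnion ht hg))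
    · exact .inl hQ

theorem Atom.IsEq.holds {M : Model S} {e : ∀ s : Srt S.USort, GTerm S s → M.Dom s}
    {a : Atom S (NoVar S)} {s : Srt S.USort} {t u : GTerm S s} (h : a.IsEq t u) :
    a.Holds M e ↔ e s t = e s u := by
  rcases h with rfl | rfl
  · rfl
  · exact eq_comm

theorem Atom.IsEq.left_mem {a : Atom S (NoVar S)} {s : Srt S.USort} {t u : GTerm S s}
    (h : a.IsEq t u) : (⟨s, t⟩ : Σ s, GTerm S s) ∈ a.terms := by
  rcases h with rfl | rfl
  · exact .inl rfl
  · exact .inr rfl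

theorem Atom.IsEq.right_mem {a : Atom S (NoVar S)} {s : Srt S.USort} {t u : GTerm S s}
    (h : a.IsEq t u) : (⟨s, u⟩ : Σ s, GTerm S s) ∈ a.terms := by
  rcases h with rfl | rfl
  · exact .inr rfl
  · exact .inl rfl

theorem isPartialInterpolant_cong [Finite V] {f : Sym S}
    {t u : ∀ i : Fin f.dom.length, GTerm S (f.dom.get i)} {a : Atom S (NoVar S)}
    {b : Fin f.dom.length → Atom S (NoVar S)} (ha : a.IsEq (.app f t) (.app f u))
    (hb : ∀ x, (b x).IsEq (t x) (u x)) {q : T.Leaf}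
    (hq : q ∈ partitions (fun p => cnfFormula (K p)) f)
    (hC : C = ⟨true, .base a⟩ :: List.ofFn (fun x => ⟨false, .base (b x)⟩))
    (hJ : ∀ v, J v = attributed colour q (T.st v) C) :
    IsPartialInterpolant T K colour C J := by
  subst hC
  refine isPartialInterpolant_attributed _ ?_ (fun M ρ hF hflat => ?_) hJ
  · intro l hl Q hQ
    rcases List.mem_cons.1 hl with rfl | hl
    · cases hQ
    · obtain ⟨x, rfl⟩ := List.mem_ofFn.1 hl
      cases hQ
  · rw [List.exists_mem_cons_iff, Lit.holds_true]
    by_cases h : ∀ x, (b x).Holds M (flatValue M ρ)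
    · refine .inl (ha.holds.2 ?_)
      refine (hflat f t hq).trans (Eq.trans ?_ (hflat f u hq).symm)
      congr 1
      funext i
      exact (hb i).holds.1 (h i)
    · push Not at h
      obtain ⟨x, hx⟩ := h
      exact .inr ⟨_, List.mem_ofFn.2 ⟨x, rfl⟩, Lit.holds_false.2 hx⟩

/-! ### Trichotomy -/

/-- Exactly one of `t = u`, `t > u`, `t < u` holds, so "all literals in `A` are false" and "some
literal outside `A` is true" are equivalent. Hence the choice at each tree node is immaterial and
every label may be read as a kernel. -/
theorem isPartialInterpolant_trich [Finite V] {t u : GTerm S .rat} {a : Atom S (NoVar S)}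
    (ha : a.IsEq t u)
    (hC : C = [⟨true, .base a⟩,
        ⟨false, .base (.le (Finsupp.single t 1 - Finsupp.single u 1) 0)⟩,
        ⟨false, .base (.le (Finsupp.single u 1 - Finsupp.single t 1) 0)⟩])
    (hJ : ∀ v, J v = kernel colour (T.st v) C ∨ J v = .neg (kernel colour (T.st v)ᶜ C)) :
    IsPartialInterpolant T K colour C J := by
  have hle : ∀ (M : Model S) (e : ∀ s : Srt S.USort, GTerm S s → M.Dom s) (t u : GTerm S .rat),
      (Atom.le (Finsupp.single t 1 - Finsupp.single u 1) 0 : Atom S (NoVar S)).Holds M e ↔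
        (e .rat t : ℚ) ≤ (e .rat u : ℚ) := by
    intro M e t u
    simp only [Atom.Holds]
    rw [Finsupp.sum_sub_index (fun _ _ _ => sub_mul _ _ _), Finsupp.sum_single_index (zero_mul _),
      Finsupp.sum_single_index (zero_mul _)]
    constructor <;> intro h <;> linarith
  have hkey : ∀ (M : Model S) (ρ : Assign M (Var S)) (A : Set T.Leaf),
      ¬ (kernel colour Aᶜ C).eval M ρ ↔ (kernel colour A C).eval M ρ := by
    intro M ρ A
    rw [eval_kernel, eval_kernel, hC]
    simp only [List.forall_mem_cons, Lit.holds_true, Lit.holds_false, not_not, PAtom.Holds, hle,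
      ha.holds, mem_compl_iff]
    rcases lt_trichotomy (flatValue M ρ .rat t : ℚ) (flatValue M ρ .rat u : ℚ) with h | h | h
    · have h1 : ¬ (flatValue M ρ .rat u : ℚ) ≤ (flatValue M ρ .rat t : ℚ) := h.not_ge
      have h2 : ¬ flatValue M ρ .rat t = flatValue M ρ .rat u := h.ne
      simp [h1, h2, h.le]
    · have h1 : flatValue M ρ .rat t = flatValue M ρ .rat u := h
      simp [h1]
    · have h1 : ¬ (flatValue M ρ .rat t : ℚ) ≤ (flatValue M ρ .rat u : ℚ) := h.not_ge
      have h2 : ¬ flatValue M ρ .rat t = flatValue M ρ .rat u := h.ne'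
      simp [h1, h2, h.le]
  have hev : ∀ v M ρ, (J v).eval M ρ ↔
      ∀ l ∈ C, colour l.atom ∈ T.st v → ¬ l.Holds M (flatValue M ρ) := by
    intro v M ρ
    rw [← eval_kernel]
    rcases hJ v with h | h <;> rw [h]
    exact hkey M ρ _
  refine ⟨?_, ?_, ?_, ?_⟩
  · intro M ρ h
    rw [hev, ← eval_kernel, ← hkey, eval_kernel, T.st_root] at h
    exact h fun l _ hl => (hl (mem_univ _)).elim
  · intro p M ρ _ _ h
    rw [hev, T.st_leaf]
    exact h
  · intro v a b hab ha hb M ρ h1 h2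
    rw [hev] at h1 h2 ⊢
    rw [T.st_inner hab ha hb]
    exact fun l hl h => h.elim (h1 l hl) (h2 l hl)
  · intro v
    have hk : ∀ A : Set T.Leaf, (kernel colour A C).syms = ∅ := by
      refine fun A => syms_kernel colour fun l hl Q hQ => ?_
      simp only [hC, List.mem_cons, List.not_mem_nil, or_false] at hl
      rcases hl with rfl | rfl | rfl <;> cases hQ
    have : (J v).syms = ∅ := by
      rcases hJ v with h | h <;> rw [h]
      exacts [hk _, hk _]
    rw [this]
    exact empty_subset _

/-! ### Farkas lemmas -/

/-- The value of the left-hand side minus the right-hand side of a row, times its coefficient. -/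
def FarkasRow.excess (M : Model S) (e : ∀ s : Srt S.USort, GTerm S s → M.Dom s)
    (r : FarkasRow S) : ℚ := r.k * ((r.L.sum fun t k => k * (e .rat t : ℚ)) - r.b)

theorem sum_excess (M : Model S) (e : ∀ s : Srt S.USort, GTerm S s → M.Dom s)
    (rows : List (FarkasRow S)) :
    (rows.map (FarkasRow.excess M e)).sum =
      (Finsupp.sum (rows.map fun r => r.k • r.L).sum fun t k => k * (e .rat t : ℚ)) -
        (rows.map fun r => r.k * r.b).sum := by
  induction rows with
  | nil => simp
  | cons r rows ih =>
    simp only [List.map_cons, List.sum_cons, ih]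
    rw [Finsupp.sum_add_index' (fun _ => zero_mul _) (fun _ _ _ => add_mul _ _ _),
      Finsupp.sum_smul_index (fun _ => zero_mul _)]
    simp only [FarkasRow.excess, mul_assoc, Finsupp.sum, ← Finset.mul_sum]
    ring

/-- Flattening commutes with linear combinations, so the Farkas label is itself a flattened
inequality. -/
theorem sum_smul_flatLin (rows : List (FarkasRow S)) :
    (rows.map fun r => r.k • flatLin r.L).sum = flatLin (rows.map fun r => r.k • r.L).sum := by
  induction rows with
  | nil => exact Finsupp.mapDomain_zero.symm
  | cons r rows ih =>
    simp only [List.map_cons, List.sum_cons, ih]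
    simp only [flatLin, Finsupp.mapDomain_add, Finsupp.mapDomain_smul]

theorem sum_map_filter_eq {α : Type} (p : α → Prop) (w : α → ℚ) (l : List α) :
    ((l.filter fun x => decide (p x)).map w).sum =
      (l.map fun x => if p x then w x else 0).sum := by
  induction l with
  | nil => rfl
  | cons a l ih => by_cases h : p a <;> simp [h, ih]

/-- Writing the sum over all rows with an indicator, instead of over the filtered list, makes it
visibly additive in disjoint sets `A`. -/
theorem eval_farkasInterp {P : Type} (colour : PAtom S → P) (A : Set P) (M : Model S)
    (ρ : Assign M (Var S)) (rows : List (FarkasRow S)) :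
    (farkasInterp colour A rows).eval M ρ ↔ (¬ ∀ r ∈ rows, colour r.atom ∈ A) ∧
      (rows.map fun r => if colour r.atom ∈ A then r.excess M (flatValue M ρ) else 0).sum ≤ 0 := by
  unfold farkasInterp
  split_ifs with h
  · exact ⟨False.elim, fun h' => h'.1 h⟩
  · simp only [h, not_false_eq_true, true_and]
    rw [← sum_map_filter_eq, sum_excess, sub_nonpos, sum_smul_flatLin]
    exact holds_flatLin ..

theorem isPartialInterpolant_farkas [Finite V] {rows : List (FarkasRow S)}
    (hk : ∀ r ∈ rows, 0 < r.k) (hL : (rows.map fun r => r.k • r.L).sum = 0)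
    (hb : (rows.map fun r => r.k * r.b).sum < 0)
    (hC : C = rows.map (fun r => ⟨false, r.atom⟩))
    (hJ : ∀ v, J v = farkasInterp colour (T.st v) rows) :
    IsPartialInterpolant T K colour C J := by
  have htot : ∀ (M : Model S) (e : ∀ s : Srt S.USort, GTerm S s → M.Dom s),
      0 < (rows.map (FarkasRow.excess M e)).sum := by
    intro M e
    rw [sum_excess, hL]
    simpa using hb
  -- With all rows in `A` the sum would be the total excess, which is positive. So a nonpositive sum
  -- already excludes the `⊥` case, and only the sums need to be tracked below.
  have hall : ∀ (M : Model S) (e : ∀ s : Srt S.USort, GTerm S s → M.Dom s) (A : Set T.Leaf),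
      (rows.map fun r => if colour r.atom ∈ A then r.excess M e else 0).sum ≤ 0 →
      ¬ ∀ r ∈ rows, colour r.atom ∈ A := by
    intro M e A h hA
    rw [List.map_congr_left fun r hr => if_pos (hA r hr)] at h
    exact (htot M e).not_ge h
  have hev : ∀ v M ρ, (J v).eval M ρ ↔ (¬ ∀ r ∈ rows, colour r.atom ∈ T.st v) ∧
      (rows.map fun r => if colour r.atom ∈ T.st v then r.excess M (flatValue M ρ)
        else 0).sum ≤ 0 := by
    intro v M ρ
    rw [hJ v]
    exact eval_farkasInterp ..
  refine ⟨?_, ?_, ?_, ?_⟩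
  · intro M ρ h
    rw [hev, T.st_root] at h
    exact h.1 fun _ _ => mem_univ _
  · intro p M ρ _ _ h
    have hs : (rows.map fun r => if colour r.atom ∈ T.st p.1 then r.excess M (flatValue M ρ)
        else 0).sum ≤ 0 := by
      refine (List.sum_le_sum (g := fun _ => 0) fun r hr => ?_).trans (by simp)
      split_ifs with hrp
      · rw [T.st_leaf] at hrp
        have := h ⟨false, r.atom⟩ (hC ▸ List.mem_map.2 ⟨r, hr, rfl⟩) hrp
        rw [Lit.holds_false, not_not] at this
        exact mul_nonpos_of_nonneg_of_nonpos (hk r hr).le (sub_nonpos.2 this)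
      · exact le_rfl
    exact (hev ..).2 ⟨hall M _ _ hs, hs⟩
  · intro v a b hab ha hb M ρ h1 h2
    rw [hev] at h1 h2 ⊢
    have hdis := disjoint_left.1 (T.st_disjoint hab ha hb)
    have hs : (rows.map fun r => if colour r.atom ∈ T.st v then r.excess M (flatValue M ρ)
        else 0).sum ≤ 0 := by
      refine le_trans (le_of_eq ?_) (add_nonpos h1.2 h2.2)
      rw [← List.sum_map_add]
      congr 1
      refine List.map_congr_left fun r _ => ?_
      rw [T.st_inner hab ha hb]
      by_cases h1 : colour r.atom ∈ T.st a
      · rw [if_pos h1, if_neg (hdis h1), if_pos (.inl h1), add_zero]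
      · by_cases h2 : colour r.atom ∈ T.st b
        · rw [if_neg h1, if_pos h2, if_pos (.inr h2), zero_add]
        · rw [if_neg h1, if_neg h2, if_neg fun h => h.elim h1 h2, add_zero]
    exact ⟨hall M _ _ hs, hs⟩
  · intro v
    have : (J v).syms = ∅ := by
      rw [hJ v, farkasInterp]
      split_ifs
      · rfl
      · simp only [Formula.syms]
        rw [sum_smul_flatLin, syms_flatLin]
    rw [this]
    exact empty_subset _

theorem flatFree_farkasInterp {P : Type} (colour : PAtom S → P) (A : Set P)
    (rows : List (FarkasRow S)) : FlatFree
      (fun _ t => Supported (rows.map fun r => ⟨false, r.atom⟩) t)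
      (farkasInterp colour A rows) := by
  intro x hx
  unfold farkasInterp at hx
  split_ifs at hx
  · exact hx.elim
  · simp only [Formula.free] at hx
    rw [sum_smul_flatLin] at hx
    obtain ⟨t, ht, rfl⟩ := vars_flatLin hx
    refine ⟨_, t, rfl, ?_⟩
    have key : ∀ l : List (FarkasRow S), t ∈ Finsupp.support (l.map fun r => r.k • r.L).sum →
        ∃ r ∈ l, t ∈ r.L.support := by
      intro l hl
      induction l with
      | nil => simp at hl
      | cons r l ih =>
        rcases Finset.mem_union.1 (Finsupp.support_add hl) with h | h
        · exact ⟨r, List.mem_cons_self, Finsupp.support_smul h⟩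
        · obtain ⟨r', hr', h⟩ := ih h
          exact ⟨r', List.mem_cons_of_mem _ hr', h⟩
    obtain ⟨r, hr, ht⟩ := key _ ht
    exact ⟨⟨false, r.atom⟩, List.mem_map.2 ⟨r, List.mem_of_mem_filter hr, rfl⟩, .le r.L r.b, rfl, ⟨_, t⟩, ⟨t, ht, rfl⟩, .refl⟩

end Rules

/-! ### Transitivity -/

section Chains

variable {P : Type} (colour : PAtom S → P) {D : Type} {s : Srt S.USort}

/-- The blocks of consecutive links of a chain with a colour in `A` have end points of equal value;
here `x` is the value that is attributed to the start of the first block and `y` the one that is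
attributed to the end of the last. -/
def BlocksEqual (A : Set P) (val : GTerm S s → D) (y : D) :
    D → GTerm S s → List (Atom S (NoVar S) × GTerm S s) → Prop
  | x, _, [] => x = y
  | x, t, (a, u) :: r =>
      if colour (.base a) ∈ A then BlocksEqual A val y x u r
      else x = val t ∧ BlocksEqual A val y (val u) u r

/-- The last term of a chain. -/
def chainEnd : GTerm S s → List (Atom S (NoVar S) × GTerm S s) → GTerm S s
  | t, [] => t
  | _, (_, u) :: r => chainEnd u r

/-- At any term of the chain at most one of `A` and `B` is inside a block, and the other has just
restarted with the value of the current term. The disjunctions record this: the start (or end)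
attributed for the union is that of one set, and the other set has the current term's (or last
term's) value. A passage from an `A`-block to a `B`-block joins them at the value of their common
term. -/
theorem blocksEqual_union {A B : Set P} (hdis : Disjoint A B) {val : GTerm S s → D}
    {y y₁ y₂ : D} (steps : List (Atom S (NoVar S) × GTerm S s)) :
    ∀ {t : GTerm S s} {x x₁ x₂ : D},
    (x = x₁ ∧ x₂ = val t) ∨ (x = x₂ ∧ x₁ = val t) →
    (y = y₁ ∧ y₂ = val (chainEnd t steps)) ∨ (y = y₂ ∧ y₁ = val (chainEnd t steps)) →
    BlocksEqual colour A val y₁ x₁ t steps → BlocksEqual colour B val y₂ x₂ t steps →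
    BlocksEqual colour (A ∪ B) val y x t steps := by
  induction steps with
  | nil =>
    intro t x x₁ x₂ hx hy h₁ h₂
    simp only [BlocksEqual, chainEnd] at *
    grind
  | cons st r ih =>
    obtain ⟨a, u⟩ := st
    intro t x x₁ x₂ hx hy h₁ h₂
    simp only [BlocksEqual, chainEnd] at *
    by_cases hA : colour (.base a) ∈ A
    · rw [if_pos hA] at h₁
      rw [if_neg (disjoint_left.1 hdis hA)] at h₂
      rw [if_pos (.inl hA)]
      exact ih (.inl ⟨by grind, rfl⟩) hy h₁ h₂.2
    rw [if_neg hA] at h₁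
    by_cases hB : colour (.base a) ∈ B
    · rw [if_pos hB] at h₂
      rw [if_pos (.inr hB)]
      exact ih (.inr ⟨by grind, rfl⟩) hy h₁.2 h₂
    · rw [if_neg hB] at h₂
      rw [if_neg fun h => h.elim hA hB]
      exact ⟨by grind, ih (.inl ⟨rfl, rfl⟩) hy h₁.2 h₂.2⟩

theorem blocksEqual_of_links {A : Set P} {M : Model S}
    {e : ∀ s : Srt S.USort, GTerm S s → M.Dom s} {t₀ : GTerm S s} {d : Atom S (NoVar S)}
    (steps : List (Atom S (NoVar S) × GTerm S s)) : ∀ {t : GTerm S s}, IsChain t₀ d t steps →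
    (∀ st ∈ steps, colour (.base st.1) ∈ A → st.1.Holds M e) →
    BlocksEqual colour A (e s) (e s (chainEnd t steps)) (e s t) t steps := by
  induction steps with
  | nil => intros; rfl
  | cons st r ih =>
    obtain ⟨a, u⟩ := st
    intro t hch h
    rw [List.forall_mem_cons] at h
    have := ih hch.2 h.2
    simp only [BlocksEqual, chainEnd]
    split_ifs with hA
    · rw [hch.1.holds.1 (h.1 hA)]
      exact this
    · exact ⟨trivial, this⟩

theorem isEq_chainEnd {t₀ : GTerm S s} {d : Atom S (NoVar S)}
    (steps : List (Atom S (NoVar S) × GTerm S s)) : ∀ {t : GTerm S s}, IsChain t₀ d t steps →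
    d.IsEq t₀ (chainEnd t steps) := by
  induction steps with
  | nil => exact fun h => h
  | cons st r ih => exact fun h => ih h.2

theorem eq_of_blocksEqual_univ {val : GTerm S s → D}
    {x y : D} (steps : List (Atom S (NoVar S) × GTerm S s)) : ∀ {t : GTerm S s},
    BlocksEqual colour univ val y x t steps → x = y := by
  induction steps with
  | nil => exact fun h => h
  | cons st r ih =>
    intro t h
    rw [BlocksEqual, if_pos (mem_univ _)] at h
    exact ih h

theorem eval_pairUp_cons (M : Model S) (ρ : Assign M (Var S)) (t u : GTerm S s)
    (l : List (GTerm S s)) : (pairUp (t :: u :: l)).eval M ρ ↔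
      flatValue M ρ s t = flatValue M ρ s u ∧ (pairUp l).eval M ρ := Iff.rfl

theorem boundary_cons (A : Set P) (close prev : Bool) (t : GTerm S s) (a : Atom S (NoVar S))
    (u : GTerm S s) (r : List (Atom S (NoVar S) × GTerm S s)) :
    boundary colour A close prev t ((a, u) :: r) =
      (if prev = decide (colour (.base a) ∈ A) then [] else [t]) ++
        boundary colour A close (decide (colour (.base a) ∈ A)) u r := rfl

/-- With the disequality outside `A`, boundary terms alternate between starts and ends of blocks, so
pairing them equates the end points of each block. The two claims are the states of the scan:
outside a block, and inside one that was opened at `b`. -/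
theorem eval_pairUp_boundary (A : Set P) (M : Model S) (ρ : Assign M (Var S))
    (steps : List (Atom S (NoVar S) × GTerm S s)) : ∀ t : GTerm S s,
    ((pairUp (boundary colour A false false t steps)).eval M ρ ↔
      BlocksEqual colour A (flatValue M ρ s) (flatValue M ρ s (chainEnd t steps))
        (flatValue M ρ s t) t steps) ∧
    ∀ b : GTerm S s, (pairUp (b :: boundary colour A false true t steps)).eval M ρ ↔
      BlocksEqual colour A (flatValue M ρ s) (flatValue M ρ s (chainEnd t steps))
        (flatValue M ρ s b) t steps := by
  induction steps with
  | nil =>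
    refine fun t => ⟨?_, fun b => ?_⟩
    · simp [boundary, BlocksEqual, chainEnd, pairUp, Formula.eval]
    · simp only [boundary, BlocksEqual, chainEnd, Bool.true_eq_false, if_false, eval_pairUp_cons]
      simp [pairUp, Formula.eval]
  | cons st r ih =>
    obtain ⟨a, u⟩ := st
    intro t
    obtain ⟨ih₁, ih₂⟩ := ih u
    by_cases hA : colour (.base a) ∈ A
    · simp only [boundary_cons, hA, decide_true, Bool.false_eq_true, if_false, if_true,
        List.cons_append, List.nil_append, BlocksEqual, chainEnd]
      exact ⟨ih₂ t, ih₂⟩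
    · simp only [boundary_cons, hA, decide_false, Bool.true_eq_false, if_false, if_true,
        List.cons_append, List.nil_append, BlocksEqual, chainEnd, eval_pairUp_cons, ih₁]
      simp

/-- With the disequality in `A`, the last block stays open, and the unpaired last boundary term is
its start. The value `y` passed to the end of the chain is thus that term's value, and it has to
differ from `x`. The list is nonempty, so the default `c` plays no role. -/
theorem eval_pairUp_boundary_closed (A : Set P) (M : Model S) (ρ : Assign M (Var S))
    (x : M.Dom s) (steps : List (Atom S (NoVar S) × GTerm S s)) : ∀ t : GTerm S s,
    (∀ c : GTerm S s, ((pairUp (boundary colour A true false t steps)).eval M ρ ∧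
        flatValue M ρ s ((boundary colour A true false t steps).getLastD c) ≠ x ↔
      ∃ y, x ≠ y ∧ BlocksEqual colour A (flatValue M ρ s) y (flatValue M ρ s t) t steps)) ∧
    ∀ b c : GTerm S s, ((pairUp (b :: boundary colour A true true t steps)).eval M ρ ∧
        flatValue M ρ s ((b :: boundary colour A true true t steps).getLastD c) ≠ x ↔
      ∃ y, x ≠ y ∧ BlocksEqual colour A (flatValue M ρ s) y (flatValue M ρ s b) t steps) := by
  induction steps with
  | nil =>
    refine fun t => ⟨fun c => ?_, fun b c => ?_⟩
    · simp [boundary, BlocksEqual, pairUp, Formula.eval, eq_comm]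
    · simp [boundary, BlocksEqual, pairUp, Formula.eval, eq_comm]
  | cons st r ih =>
    obtain ⟨a, u⟩ := st
    intro t
    obtain ⟨ih₁, ih₂⟩ := ih u
    by_cases hA : colour (.base a) ∈ A
    · simp only [boundary_cons, hA, decide_true, Bool.false_eq_true, if_false, if_true,
        List.cons_append, List.nil_append, BlocksEqual]
      exact ⟨ih₂ t, ih₂⟩
    · simp only [boundary_cons, hA, decide_false, Bool.true_eq_false, if_false, if_true,
        List.cons_append, List.nil_append, BlocksEqual, eval_pairUp_cons]
      refine ⟨by simpa using ih₁, fun b c => ?_⟩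
      rw [List.getLastD_cons, List.getLastD_cons, and_assoc, ih₁ t]
      constructor
      · rintro ⟨h, y, hy, hb⟩
        exact ⟨y, hy, h, hb⟩
      · rintro ⟨y, hy, h, hb⟩
        exact ⟨h, y, hy, hb⟩

/-- The chain begins inside the block of the disequality, and its attributed start `x` is unknown
until the first link outside `A`; that link's left term is the first boundary term and fixes `x`.
Without such a link the boundary is empty and the blocks force `x = y`, so both sides are false. -/
theorem eval_boundary_open (A : Set P) (M : Model S) (ρ : Assign M (Var S))
    (steps : List (Atom S (NoVar S) × GTerm S s)) : ∀ t : GTerm S s,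
    (∃ (b : GTerm S s) (l : List (GTerm S s)), boundary colour A true true t steps = b :: l ∧
      (pairUp l).eval M ρ ∧ flatValue M ρ s (l.getLastD b) ≠ flatValue M ρ s b) ↔
    ∃ x y, x ≠ y ∧ BlocksEqual colour A (flatValue M ρ s) y x t steps := by
  induction steps with
  | nil =>
    intro t
    simp [boundary, BlocksEqual]
  | cons st r ih =>
    obtain ⟨a, u⟩ := st
    intro t
    by_cases hA : colour (.base a) ∈ A
    · simp only [boundary_cons, hA, decide_true, if_true, List.nil_append, BlocksEqual]
      exact ih u
    · simp only [boundary_cons, hA, decide_false, Bool.true_eq_false, if_false,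
        List.cons_append, List.nil_append, BlocksEqual]
      have key := (eval_pairUp_boundary_closed colour A M ρ (flatValue M ρ s t) r u).1 t
      constructor
      · rintro ⟨b, l, h, hl⟩
        obtain ⟨rfl, rfl⟩ := List.cons.inj h
        obtain ⟨y, hy, hb⟩ := key.1 hl
        exact ⟨_, y, hy, rfl, hb⟩
      · rintro ⟨x, y, hy, rfl, hb⟩
        exact ⟨t, _, rfl, key.2 ⟨y, hy, hb⟩⟩

/-- This removes the boundary lists: a disequality in `A` contributes two distinct but otherwise
arbitrary values for the ends of the chain, and one outside `A` leaves the ends at their own values.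
-/
theorem eval_transInterp (A : Set P) (M : Model S) (ρ : Assign M (Var S)) (t : GTerm S s)
    (steps : List (Atom S (NoVar S) × GTerm S s)) (d : Atom S (NoVar S)) :
    (transInterp colour A t steps d).eval M ρ ↔
      if colour (.base d) ∈ A then
        ∃ x y, x ≠ y ∧ BlocksEqual colour A (flatValue M ρ s) y x t steps
      else BlocksEqual colour A (flatValue M ρ s) (flatValue M ρ s (chainEnd t steps))
        (flatValue M ρ s t) t steps := by
  unfold transInterp
  by_cases hA : colour (.base d) ∈ A
  · simp only [hA, decide_true, if_true]
    rw [← eval_boundary_open]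
    cases boundary colour A true true t steps with
    | nil => simp [Formula.eval]
    | cons b l =>
      constructor
      · exact fun h => ⟨b, l, rfl, h⟩
      · rintro ⟨b', l', h, hl⟩
        obtain ⟨rfl, rfl⟩ := List.cons.inj h
        exact hl
  · simp only [hA, decide_false, if_false]
    rw [← (eval_pairUp_boundary colour A M ρ steps t).1]
    cases boundary colour A false false t steps with
    | nil => rfl
    | cons b l => rfl

theorem free_pairUp : ∀ (l : List (GTerm S s)) {x : Σ s, Var S s}, x ∈ (pairUp l).free →
    ∃ t ∈ l, x = ⟨s, .flat t⟩
  | [], _, hx => hx.elim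
  | [_], _, hx => hx.elim
  | t :: u :: l, x, hx => by
    rcases hx with hx | hx
    · rcases vars_eq_flatVar hx with h | h
      · exact ⟨t, by simp, h⟩
      · exact ⟨u, by simp, h⟩
    · obtain ⟨w, hw, h⟩ := free_pairUp l hx
      exact ⟨w, by simp [hw], h⟩

theorem syms_pairUp : ∀ l : List (GTerm S s), (pairUp l).syms = ∅
  | [] => rfl
  | [_] => rfl
  | t :: u :: l => by
    simp only [pairUp, Formula.syms, syms_pairUp l, union_empty]
    exact syms_eq_flatVar t u

theorem mem_boundary (A : Set P) {t₀ : GTerm S s} {d : Atom S (NoVar S)} {c : Bool}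
    {w : GTerm S s} (steps : List (Atom S (NoVar S) × GTerm S s)) :
    ∀ {prev : Bool} {t : GTerm S s}, IsChain t₀ d t steps →
    w ∈ boundary colour A c prev t steps →
    (⟨s, w⟩ : Σ s, GTerm S s) ∈ d.terms ∨
      ∃ st ∈ steps, (⟨s, w⟩ : Σ s, GTerm S s) ∈ st.1.terms := by
  induction steps with
  | nil =>
    intro prev t hch hw
    unfold boundary at hw
    split_ifs at hw
    · simp at hw
    · rw [List.mem_singleton.1 hw]
      exact .inl (Atom.IsEq.right_mem hch)
  | cons st r ih =>
    obtain ⟨a, u⟩ := st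
    intro prev t hch hw
    rw [boundary_cons, List.mem_append] at hw
    rcases hw with hw | hw
    · split_ifs at hw
      · simp at hw
      · rw [List.mem_singleton.1 hw]
        exact .inr ⟨_, List.mem_cons_self, hch.1.left_mem⟩
    · refine (ih hch.2 hw).imp id ?_
      rintro ⟨st, hst, h⟩
      exact ⟨st, List.mem_cons_of_mem _ hst, h⟩

theorem free_transInterp (A : Set P) (t : GTerm S s)
    (steps : List (Atom S (NoVar S) × GTerm S s)) (d : Atom S (NoVar S)) {x : Σ s, Var S s}
    (hx : x ∈ (transInterp colour A t steps d).free) :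
    ∃ w ∈ boundary colour A (decide (colour (.base d) ∈ A)) (decide (colour (.base d) ∈ A))
      t steps, x = ⟨s, .flat w⟩ := by
  unfold transInterp at hx
  cases hb : boundary colour A (decide (colour (.base d) ∈ A)) (decide (colour (.base d) ∈ A))
    t steps with
  | nil =>
    rw [hb] at hx
    simp only at hx
    split_ifs at hx <;> exact hx.elim
  | cons b l =>
    rw [hb] at hx
    simp only at hx
    split_ifs at hx
    · rcases hx with hx | hx
      · obtain ⟨w, hw, h⟩ := free_pairUp l hx
        exact ⟨w, List.mem_cons_of_mem _ hw, h⟩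
      · rcases vars_eq_flatVar hx with h | h
        · refine ⟨_, ?_, h⟩
          rw [← List.getLastD_cons (a := b)]
          cases l with
          | nil => simp
          | cons c l => simp [List.getLastD_eq_getLast?, List.getLast?_eq_some_getLast]
        · exact ⟨b, List.mem_cons_self, h⟩
    · exact free_pairUp _ hx

theorem syms_transInterp (A : Set P) (t : GTerm S s)
    (steps : List (Atom S (NoVar S) × GTerm S s)) (d : Atom S (NoVar S)) :
    (transInterp colour A t steps d).syms = ∅ := by
  unfold transInterp
  split
  · split_ifs <;> rfl
  · split_ifs
    · simp only [Formula.syms, syms_pairUp, empty_union]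
      exact syms_eq_flatVar _ _
    · exact syms_pairUp _

end Chains

section Rules

variable {T : InterpTree V} {K : T.Leaf → CNF S} {colour : PAtom S → T.Leaf} {C : Clause S}
  {J : V → Formula S}

/-- At the root all links form a single block from `x` to `y`, contradicting `x ≠ y`. At inner nodes
the child whose colours include the disequality determines `x` and `y`, and the blocks of the
children are merged. -/
theorem isPartialInterpolant_trans [Finite V] {s : Srt S.USort} {t : GTerm S s}
    {steps : List (Atom S (NoVar S) × GTerm S s)} {d : Atom S (NoVar S)}
    (hch : IsChain t d t steps)
    (hC : C = steps.map (fun x => ⟨false, .base x.1⟩) ++ [⟨true, .base d⟩])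
    (hJ : ∀ v, J v = transInterp colour (T.st v) t steps d) :
    IsPartialInterpolant T K colour C J := by
  refine ⟨?_, ?_, ?_, ?_⟩
  · intro M ρ h
    rw [hJ, eval_transInterp, T.st_root, if_pos (mem_univ _)] at h
    obtain ⟨x, y, hxy, h⟩ := h
    exact hxy (eq_of_blocksEqual_univ colour steps h)
  · intro p M ρ _ _ h
    have hd := isEq_chainEnd steps hch
    have hb := blocksEqual_of_links colour (A := T.st p.1) (M := M) (e := flatValue M ρ) steps
      hch (by
        intro st hst hp
        rw [T.st_leaf] at hp
        have := h ⟨false, .base st.1⟩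
          (hC ▸ List.mem_append_left _ (List.mem_map.2 ⟨st, hst, rfl⟩)) hp
        rwa [Lit.holds_false, not_not] at this)
    rw [hJ, eval_transInterp]
    split_ifs with hp
    · refine ⟨_, _, fun he => ?_, hb⟩
      rw [T.st_leaf] at hp
      exact h ⟨true, .base d⟩ (hC ▸ List.mem_append_right _ (List.mem_singleton.2 rfl)) hp
        (Lit.holds_true.2 (hd.holds.2 he))
    · exact hb
  · intro v a b hab ha hb M ρ h1 h2
    rw [hJ, eval_transInterp] at h1 h2 ⊢
    have hdis := T.st_disjoint hab ha hb
    rw [T.st_inner hab ha hb]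
    by_cases hda : colour (.base d) ∈ T.st a
    · rw [if_pos hda] at h1
      rw [if_neg (disjoint_left.1 hdis hda)] at h2
      rw [if_pos (.inl hda)]
      obtain ⟨x, y, hxy, h1⟩ := h1
      exact ⟨x, y, hxy, blocksEqual_union colour hdis steps (.inl ⟨rfl, rfl⟩) (.inl ⟨rfl, rfl⟩)
        h1 h2⟩
    rw [if_neg hda] at h1
    by_cases hdb : colour (.base d) ∈ T.st b
    · rw [if_pos hdb] at h2
      rw [if_pos (.inr hdb)]
      obtain ⟨x, y, hxy, h2⟩ := h2
      exact ⟨x, y, hxy, blocksEqual_union colour hdis steps (.inr ⟨rfl, rfl⟩) (.inr ⟨rfl, rfl⟩)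
        h1 h2⟩
    · rw [if_neg hdb] at h2
      rw [if_neg fun h => h.elim hda hdb]
      exact blocksEqual_union colour hdis steps (.inl ⟨rfl, rfl⟩) (.inl ⟨rfl, rfl⟩) h1 h2
  · intro v
    rw [hJ v, syms_transInterp]
    exact empty_subset _

theorem flatFree_transInterp {P : Type} (colour : PAtom S → P) (A : Set P) {s : Srt S.USort}
    {t : GTerm S s} {steps : List (Atom S (NoVar S) × GTerm S s)} {d : Atom S (NoVar S)}
    (hch : IsChain t d t steps) : FlatFree (fun _ w => Supported
      (steps.map (fun x => ⟨false, .base x.1⟩) ++ [⟨true, .base d⟩]) w)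
      (transInterp colour A t steps d) := by
  intro x hx
  obtain ⟨w, hw, rfl⟩ := free_transInterp colour A t steps d hx
  refine ⟨_, w, rfl, ?_⟩
  rcases mem_boundary colour A steps hch hw with h | ⟨st, hst, h⟩
  · exact ⟨⟨true, .base d⟩, List.mem_append_right _ (List.mem_singleton.2 rfl), d, rfl, _, h,
      .refl⟩
  · exact ⟨⟨false, .base st.1⟩, List.mem_append_left _ (List.mem_map.2 ⟨st, hst, rfl⟩), st.1, rfl,
      _, h, .refl⟩

end Rules

/-! ### Resolution -/

section Rules

variable {T : InterpTree V} {K : T.Leaf → CNF S} {colour : PAtom S → T.Leaf} {C : Clause S}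
  {J : V → Formula S}

theorem FlatFree.mono {N N' : ∀ s : Srt S.USort, GTerm S s → Prop} {φ : Formula S}
    (h : FlatFree N φ) (hN : ∀ s t, N s t → N' s t) : FlatFree N' φ := by
  intro x hx
  obtain ⟨s, t, e, ht⟩ := h x hx
  exact ⟨s, t, e, hN s t ht⟩

/-- At the leaf of the pivot's colour, whichever of `l` and its complement is false completes the
negation of one premise, which gives a disjunction. Every other leaf ignores the pivot and obtains
both labels. At inner nodes at most one child carries a disjunction, so the parent condition applies
premise by premise. -/
theorem IsPartialInterpolant.combine [Finite V] {C₁ C₂ : Clause S} {l : Lit (PAtom S)}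
    {I₁ I₂ : V → Formula S} (h₁ : IsPartialInterpolant T K colour C₁ I₁)
    (h₂ : IsPartialInterpolant T K colour C₂ I₂)
    (hC₁ : ∀ x ∈ C₁, x ∈ C ∨ x = l) (hC₂ : ∀ x ∈ C₂, x ∈ C ∨ x = l.neg) :
    IsPartialInterpolant T K colour C (combine T colour l I₁ I₂) := by
  have hev : ∀ v M ρ, (TreeInterp.combine T colour l I₁ I₂ v).eval M ρ ↔
      if colour l.atom ∈ T.st v then (I₁ v).eval M ρ ∨ (I₂ v).eval M ρ
      else (I₁ v).eval M ρ ∧ (I₂ v).eval M ρ := by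
    intro v M ρ
    unfold TreeInterp.combine
    split_ifs <;> rfl
  refine ⟨?_, ?_, ?_, ?_⟩
  · intro M ρ h
    rw [hev, T.st_root, if_pos (mem_univ _)] at h
    exact h.elim (h₁.root M ρ) (h₂.root M ρ)
  · intro p M ρ hF hflat h
    rw [hev, T.st_leaf]
    split_ifs with hp
    · by_cases hl : l.Holds M (flatValue M ρ)
      · refine .inr (h₂.leaf p M ρ hF hflat fun x hx hxp => ?_)
        rcases hC₂ x hx with hx | rfl
        · exact h x hx hxp
        · rw [Lit.holds_neg, not_not]
          exact hl
      · refine .inl (h₁.leaf p M ρ hF hflat fun x hx hxp => ?_)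
        rcases hC₁ x hx with hx | rfl
        · exact h x hx hxp
        · exact hl
    · refine ⟨h₁.leaf p M ρ hF hflat fun x hx hxp => ?_,
        h₂.leaf p M ρ hF hflat fun x hx hxp => ?_⟩
      · rcases hC₁ x hx with hx | rfl
        · exact h x hx hxp
        · exact (hp hxp).elim
      · rcases hC₂ x hx with hx | rfl
        · exact h x hx hxp
        · exact (hp hxp).elim
  · intro v a b hab ha hb M ρ ha' hb'
    rw [hev] at ha' hb' ⊢
    have i₁ := h₁.inner v a b hab ha hb M ρ
    have i₂ := h₂.inner v a b hab ha hb M ρ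
    have hdis := disjoint_left.1 (T.st_disjoint hab ha hb)
    rw [T.st_inner hab ha hb]
    by_cases hla : colour l.atom ∈ T.st a
    · rw [if_pos hla] at ha'
      rw [if_neg (hdis hla)] at hb'
      rw [if_pos (.inl hla)]
      exact ha'.imp (fun h => i₁ h hb'.1) (fun h => i₂ h hb'.2)
    rw [if_neg hla] at ha'
    by_cases hlb : colour l.atom ∈ T.st b
    · rw [if_pos hlb] at hb'
      rw [if_pos (.inr hlb)]
      exact hb'.imp (i₁ ha'.1) (i₂ ha'.2)
    · rw [if_neg hlb] at hb'
      rw [if_neg fun h => h.elim hla hlb]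
      exact ⟨i₁ ha'.1 hb'.1, i₂ ha'.2 hb'.2⟩
  · intro v
    have : (TreeInterp.combine T colour l I₁ I₂ v).syms = (I₁ v).syms ∪ (I₂ v).syms := by
      unfold TreeInterp.combine
      split_ifs <;> rfl
    rw [this]
    exact union_subset (h₁.symbols v) (h₂.symbols v)

theorem flatFree_combine {l : Lit (PAtom S)} {I₁ I₂ : V → Formula S} {v : V}
    {N : ∀ s : Srt S.USort, GTerm S s → Prop} (h₁ : FlatFree N (I₁ v))
    (h₂ : FlatFree N (I₂ v)) : FlatFree N (combine T colour l I₁ I₂ v) := by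
  have : (combine T colour l I₁ I₂ v).free = (I₁ v).free ∪ (I₂ v).free := by
    unfold combine
    split_ifs <;> rfl
  intro x hx
  rw [this] at hx
  exact hx.elim (h₁ x) (h₂ x)

/-- Support by `C` fails while removal is under way, so the steps preserve the weaker fact that the
symbols of the free terms occur in the input; support is regained from the stopping condition. -/
theorem IsPartialInterpolant.removeAll [Finite V] {J' : V → Formula S}
    (h : IsPartialInterpolant T K colour C J)
    (hfree : ∀ v, FlatFree
      (fun _ t => ∀ g ∈ t.syms, ∃ p, g ∈ (cnfFormula (K p)).syms) (J v))
    (hJ : RemoveAll T (fun p => cnfFormula (K p)) C J J') :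
    IsPartialInterpolant T K colour C J' ∧ ∀ v, FlatFree (fun _ t => Supported C t) (J' v) := by
  have key : IsPartialInterpolant T K colour C J' ∧ ∀ v, FlatFree
      (fun _ t => ∀ g ∈ t.syms, ∃ p, g ∈ (cnfFormula (K p)).syms) (J' v) := by
    obtain ⟨hsteps, -⟩ := hJ
    induction hsteps with
    | refl => exact ⟨h, hfree⟩
    | tail _ hstep ih =>
      refine ⟨ih.1.removeStep ih.2 hstep, fun v => FlatFree.removeStep ?_ ih.2 hstep v⟩
      exact fun hu htu g hg => hu g (htu.syms_subset hg)
  refine ⟨key.1, fun v x hx => ?_⟩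
  obtain ⟨s, t, rfl, -⟩ := key.2 v x hx
  exact ⟨s, t, rfl, hJ.2 v s t hx⟩

end Rules

/-! ## Runs of the algorithm -/

section Runs

variable {T : InterpTree V} {K : T.Leaf → CNF S} {π : ResProof K} {colour : PAtom S → T.Leaf}

theorem ResProof.SymbolsFromInput.of_supported (hsym : π.SymbolsFromInput) {i : Fin π.size}
    {s : Srt S.USort} {t : GTerm S s} (ht : Supported (π.clause i) t) :
    ∀ g ∈ t.syms, ∃ p, g ∈ (cnfFormula (K p)).syms := by
  intro g hg
  obtain ⟨l, hl, a, ha, u, hu, htu⟩ := ht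
  exact hsym i g (base_syms_subset_clauseFormula hl ha (mem_biUnion hu (htu.syms_subset hg)))

/-- Nodes are labelled in order of their index. Resolution needs termination of removal, and
congruence needs a partition of `f`, which exists because `f` occurs in the proof. -/
theorem ResProof.exists_isRun [Finite V] (hsym : π.SymbolsFromInput) :
    ∃ I : Fin π.size → V → Formula S, π.IsRun colour I := by
  have main : ∀ n : ℕ, ∃ I : Fin π.size → V → Formula S, ∀ i : Fin π.size, i.1 < n →
      (π.rule i).Computes T (fun p => cnfFormula (K p)) colour I (π.clause i) (I i) := by
    intro n
    induction n with
    | zero => exact ⟨fun _ _ => .top, fun i hi => (Nat.not_lt_zero _ hi).elim⟩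
    | succ n ih =>
      obtain ⟨I, hI⟩ := ih
      by_cases hn : n < π.size
      swap
      · exact ⟨I, fun i _ => hI i (i.2.trans_le (not_lt.1 hn))⟩
      set m : Fin π.size := ⟨n, hn⟩ with hm
      have hlabel : ∃ J, (π.rule m).Computes T (fun p => cnfFormula (K p)) colour I
          (π.clause m) J := by
        have hval := π.valid m
        cases hr : π.rule m with
        | input p | inst Q θ | trans s t steps d | farkas rows => exact ⟨_, fun v => rfl⟩
        | trich t u => exact ⟨_, fun v => .inl rfl⟩
        | cong f t u =>
          rw [hr] at hval
          obtain ⟨a, b, ha, -, hC⟩ := hval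
          obtain ⟨p, hp⟩ := partitions_nonempty (T := T) (K := K) (f := f) (fun g hg => by
            refine hsym.of_supported (i := m) (t := .app f t) ?_ g (.inl hg)
            exact ⟨⟨true, .base a⟩, hC ▸ List.mem_cons_self, a, rfl, _, ha.left_mem, .refl⟩)
            (colour (.proxy []))
          exact ⟨_, p, hp, fun v => rfl⟩
        | res j k l => exact exists_removeAll T _ _ _
      obtain ⟨J, hJ⟩ := hlabel
      -- Writing the label of `m` does not affect nodes up to `m`: only resolution reads other
      -- labels, and its premises come strictly earlier.
      have hcongr : ∀ (i : Fin π.size) (J' : V → Formula S), i.1 ≤ n →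
          (π.rule i).Computes T (fun p => cnfFormula (K p)) colour I (π.clause i) J' →
          (π.rule i).Computes T (fun p => cnfFormula (K p)) colour (Function.update I m J)
            (π.clause i) J' := by
        intro i J' hi h
        have hval := π.valid i
        cases hr : π.rule i with
        | res j k l =>
          rw [hr] at hval h
          have hj : j ≠ m := fun e => by
            have := Fin.lt_def.1 hval.1
            rw [e] at this
            exact absurd hi (not_le.2 this)
          have hk : k ≠ m := fun e => by
            have := Fin.lt_def.1 hval.2.1
            rw [e] at this
            exact absurd hi (not_le.2 this)
          simp only [Rule.Computes] at h ⊢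
          rwa [Function.update_of_ne hj, Function.update_of_ne hk]
        | _ => rw [hr] at h; exact h
      refine ⟨Function.update I m J, fun i hi => ?_⟩
      by_cases him : i = m
      · subst him
        rw [Function.update_self]
        exact hcongr _ _ le_rfl hJ
      · rw [Function.update_of_ne him]
        have : i.1 ≠ n := fun e => him (Fin.ext e)
        exact hcongr _ _ (by omega) (hI i (by omega))
  obtain ⟨I, hI⟩ := main π.size
  exact ⟨I, fun i => hI i i.2⟩

/-- The interpolation invariant and support are proved together: support of the premises' variables
bounds the symbols that removal may meet in a resolution step. -/
theorem ResProof.IsRun.isPartialInterpolant [Finite V] (hsym : π.SymbolsFromInput)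
    (hcol : π.Admissible colour) {I : Fin π.size → V → Formula S} (hI : π.IsRun colour I)
    (i : Fin π.size) : IsPartialInterpolant T K colour (π.clause i) (I i) ∧
      ∀ v, FlatFree (fun _ t => Supported (π.clause i) t) (I i v) := by
  induction i using WellFoundedLT.induction with
  | _ i ih =>
    have hval := π.valid i
    have hcomp := hI i
    cases hr : π.rule i with
    | input p =>
      rw [hr] at hval hcomp
      obtain ⟨D, hD, hDC⟩ := hval
      refine ⟨isPartialInterpolant_input (fun l hl Q hQ => ?_) hD hDC hcomp, fun v => ?_⟩
      · rw [hQ]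
        exact hcol.input i p hr l hl Q hQ
      · rw [hcomp v]
        exact flatFree_attributed _ _ _ _
    | inst Q θ =>
      rw [hr] at hval hcomp
      obtain ⟨D, hD, hC⟩ := hval
      have hocc := hcol.occurs i ⟨false, .proxy Q⟩ (hC ▸ List.mem_cons_self) Q rfl
      constructor
      · rw [hC] at hcomp ⊢
        exact isPartialInterpolant_inst hocc hD hcomp
      · intro v
        rw [hcomp v]
        exact flatFree_attributed _ _ _ _
    | trans s t steps d =>
      rw [hr] at hval hcomp
      refine ⟨isPartialInterpolant_trans hval.1 hval.2 hcomp, fun v => ?_⟩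
      rw [hcomp v, hval.2]
      exact flatFree_transInterp colour _ hval.1
    | cong f t u =>
      rw [hr] at hval hcomp
      obtain ⟨a, b, ha, hb, hC⟩ := hval
      obtain ⟨p, hp, hcomp⟩ := hcomp
      refine ⟨isPartialInterpolant_cong ha hb hp hC hcomp, fun v => ?_⟩
      rw [hcomp v]
      exact flatFree_attributed _ _ _ _
    | trich t u =>
      rw [hr] at hval hcomp
      obtain ⟨a, ha, hC⟩ := hval
      refine ⟨isPartialInterpolant_trich ha hC hcomp, fun v => ?_⟩
      rcases hcomp v with h | h <;> rw [h]
      · exact flatFree_kernel _ _ _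
      · exact flatFree_kernel _ _ _
    | farkas rows =>
      rw [hr] at hval hcomp
      obtain ⟨hk, hL, hb, hC⟩ := hval
      refine ⟨isPartialInterpolant_farkas hk hL hb hC hcomp, fun v => ?_⟩
      rw [hcomp v, hC]
      exact flatFree_farkasInterp _ _ _
    | res j k l =>
      rw [hr] at hval hcomp
      obtain ⟨hj, hk, C₁, C₂, h₁, h₂, hC⟩ := hval
      obtain ⟨ihj, fj⟩ := ih j hj
      obtain ⟨ihk, fk⟩ := ih k hk
      have hcomb : IsPartialInterpolant T K colour (π.clause i)
          (combine T colour l (I j) (I k)) := by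
        refine ihj.combine ihk (fun x hx => ?_) (fun x hx => ?_)
        · have hx' : x ∈ {x | x ∈ C₁} ∪ {l} := h₁ ▸ hx
          refine hx'.imp (fun h => ?_) id
          have : x ∈ {x | x ∈ π.clause i} := hC ▸ Or.inl h
          exact this
        · have hx' : x ∈ {x | x ∈ C₂} ∪ {l.neg} := h₂ ▸ hx
          refine hx'.imp (fun h => ?_) id
          have : x ∈ {x | x ∈ π.clause i} := hC ▸ Or.inr h
          exact this
      exact hcomb.removeAll (fun v => flatFree_combine
        ((fj v).mono fun _ _ h => hsym.of_supported h)
        ((fk v).mono fun _ _ h => hsym.of_supported h)) hcomp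

/-- The assignment that gives each flattening variable the value of its term. -/
def valueAssign (M : Model S) (ρ : Assign M (Var S)) : Assign M (Var S)
  | ⟨_, .flat t⟩ => GTerm.value M _ t
  | ⟨s, .bnd n⟩ => ρ ⟨s, .bnd n⟩

/-- The labels are closed, so the leaf condition may be tested at `valueAssign`, where flattening
equalities hold by definition, and carried back to any assignment. -/
theorem IsPartialInterpolant.isTreeInterpolant [Finite V] {J : V → Formula S}
    (h : IsPartialInterpolant T K colour [] J)
    (hfree : ∀ v, FlatFree (fun _ t => Supported [] t) (J v)) :
    IsTreeInterpolant T (fun p => cnfFormula (K p)) J := by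
  have hclosed : ∀ v, (J v).free = ∅ := by
    refine fun v => eq_empty_of_forall_notMem fun x hx => ?_
    obtain ⟨s, t, -, l, hl, -⟩ := hfree v x hx
    cases hl
  refine ⟨h.root, fun p M ρ hF => ?_, h.inner, h.symbols, hclosed⟩
  have := h.leaf p M (valueAssign M ρ) ((eval_cnfFormula_congr M _ _ _).1 hF)
    (fun f args _ => rfl) (fun l hl => by cases hl)
  refine (Formula.eval_congr M _ fun x hx => ?_).1 this
  rw [hclosed] at hx
  exact hx.elim

end Runs

end

end TreeInterp

theorem theorem3 (S : Signature) {V : Type} [Finite V] (T : InterpTree V)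
    (K : T.Leaf → CNF S) (π : ResProof K) (hsym : π.SymbolsFromInput)
    (colour : PAtom S → T.Leaf) (hcol : π.Admissible colour) :
    (∀ C : Clause S, WellFounded fun J' J : V → Formula S =>
      RemoveStep T (fun p => cnfFormula (K p)) C J J') ∧
    (∃ I : Fin π.size → V → Formula S, π.IsRun colour I) ∧
    (∀ I : Fin π.size → V → Formula S, π.IsRun colour I →
      IsTreeInterpolant T (fun p => cnfFormula (K p)) (I π.root)) := by
  refine ⟨fun C => wellFounded_removeStep T _ C, ResProof.exists_isRun hsym, fun I hI => ?_⟩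
  obtain ⟨h, hfree⟩ := hI.isPartialInterpolant hsym hcol π.root
  rw [π.root_clause] at h hfree
  exact h.isTreeInterpolant hfree
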